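/- Let $U\subset\mathbb R^n$ be open, $T^*U=U\times\mathbb R^n$ with coordinates $(x,\xi)$ and $|\cdot|$ the Euclidean norm, and let $\chi\in C^\infty(T^*U)$ satisfy $\chi(x,\xi)=0$ for $|\xi|\le 1/2$ and $\chi(x,\xi)=1$ for $|\xi|\ge 1$. For $m\in\mathbb R$, $S^m(U)$ is the set of $\sigma\in C^\infty(T^*U)$ such that for all multi-indices $a,b$ and every compact $K\subset U$ there is a constant $C$ with $|\partial_x^a\partial_\xi^b\sigma(x,\xi)|\le C(1+|\xi|)^{m-|b|}$ for all $x\in K$, $\xi\in\mathbb R^n$. For $m\in\mathbb C$, $CS^m(U)$ is the set of $\sigma\in S^{\mathrm{Re}\,m}(U)$ for which there are $\sigma_{m-i}$, $i\ge 0$, smooth on $T^*U\setminus 0$ and positively homogeneous of degree $m-i$ in $\xi$, with $\sigma-\sum_{i=0}^{N}\chi\,\sigma_{m-i}\in S^{\mathrm{Re}\,m-N-1}(U)$ for all $N$. $CS(U)$ is the linear span of $\bigcup_{m\in\mathbb C}CS^m(U)$. For $\sigma\in CS(U)$ and $z\in\mathbb C$, the homogeneous component $\sigma_z$ of degree $z$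 is obtained by writing $\sigma$ as a finite sum of classical symbols and adding up the terms of degree $z$ in their expansions; it is uniquely determined by $\sigma$ on $T^*U\setminus 0$. $\Omega^kCS^m(U)$ is the set of complex-valued $k$-forms $\alpha=\sum_{|I|+|J|=k}\alpha_{I,J}(x,\xi)\,dx_I\wedge d\xi_J$ on $T^*U$ with $\alpha_{I,J}\in CS^{m-|J|}(U)$; $\Omega^kCS(U)$ is the linear span of $\bigcup_{m\in\mathbb C}\Omega^kCS^m(U)$, and $\Omega\,CS(U)=\bigoplus_k\Omega^kCS(U)$. A form has compact support in $U$ if it vanishes at all $(x,\xi)$ with $x$ outside some compact subset of $U$. For $\alpha\in\Omega\,CS(U)$ with compact support in $U$, the extended Wodzicki residue is $$\mathrm{res}(\alpha)=\int_U\int_{|\xi|=1}(\alpha_{I,J})_{-n}(x,\xi)\,d_S\xi\,dx,\qquad I=J=\{1,\dots,n\},$$ where $d_S\xi$ is the surface measure of the unit sphere; components with $|I|\ne n$ or $|J|\ne n$ do not contribute. **Theorem.** For every $\beta\in\Omega\,CS(U)$ with compact support in $U$, the form $d\beta$ (exterior derivative on $T^*U$) again lies in $\Omega\,CS(U)$ and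 has compact support in $U$, the integral defining $\mathrm{res}(d\beta)$ converges absolutely, and $$\mathrm{res}(d\beta)=0.$$ -/

import Mathlib

open scoped ContDiff
open MeasureTheory

noncomputable section

namespace Wodzicki

/-- The model space `ℝⁿ` with its Euclidean norm. -/
abbrev Base (n : ℕ) : Type := EuclideanSpace ℝ (Fin n)

/-- The cotangent bundle `T^*ℝⁿ = ℝⁿ × ℝⁿ`; its points are the pairs `(x, ξ)`. For an open `U`,
`T^*U` is the open subset `cotangent U`. Functions and forms on `T^*U` are represented by total
functions on `Cot n`, all conditions being imposed on `cotangent U` only. -/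
abbrev Cot (n : ℕ) : Type := Base n × Base n

/-- `T^*U = U × ℝⁿ`. -/
def cotangent {n : ℕ} (U : Set (Base n)) : Set (Cot n) := {p | p.1 ∈ U}

/-- `T^*U` with the zero section removed. -/
def cotangentMinusZero {n : ℕ} (U : Set (Base n)) : Set (Cot n) := {p | p.1 ∈ U ∧ p.2 ≠ 0}

/-- The coordinate vectors: `Sum.inl i` is `∂/∂x_i`, `Sum.inr j` is `∂/∂ξ_j`. -/
def coordVec {n : ℕ} : Fin n ⊕ Fin n → Cot n
  | Sum.inl i => (EuclideanSpace.single i 1, 0)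
  | Sum.inr j => (0, EuclideanSpace.single j 1)

/-! ### Symbols -/

/-- `σ ∈ S^m(U)`, for real `m`: `σ` is smooth on `T^*U` and every iterated partial derivative
`∂_{c 0} ⋯ ∂_{c (k-1)} σ` (in the variables `x` and `ξ`) is
`O((1 + |ξ|) ^ (m - number of ξ-derivatives))`, uniformly for `x` in compact subsets of `U`. -/
def IsSymbol {n : ℕ} (U : Set (Base n)) (m : ℝ) (σ : Cot n → ℂ) : Prop :=
  ContDiffOn ℝ ∞ σ (cotangent U) ∧
  ∀ K : Set (Base n), IsCompact K → K ⊆ U →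
    ∀ (k : ℕ) (c : Fin k → Fin n ⊕ Fin n), ∃ C : ℝ, ∀ x ∈ K, ∀ ξ : Base n,
      ‖iteratedFDeriv ℝ k σ (x, ξ) (fun i => coordVec (c i))‖ ≤
        C * (1 + ‖ξ‖) ^ (m - ((Finset.univ.filter fun i => (c i).isRight).card : ℝ))

/-- A cut-off at the zero section: smooth on `T^*U`, zero for `|ξ| ≤ 1/2`, one for `|ξ| ≥ 1`. -/
def IsCutoff {n : ℕ} (U : Set (Base n)) (χ : Cot n → ℂ) : Prop :=
  ContDiffOn ℝ ∞ χ (cotangent U) ∧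
  (∀ x ∈ U, ∀ ξ : Base n, ‖ξ‖ ≤ 1 / 2 → χ (x, ξ) = 0) ∧
  (∀ x ∈ U, ∀ ξ : Base n, 1 ≤ ‖ξ‖ → χ (x, ξ) = 1)

/-- `τ` is smooth on `T^*U - {0}` and positively homogeneous in `ξ` of complex degree `z`. -/
def IsPosHomogeneous {n : ℕ} (U : Set (Base n)) (z : ℂ) (τ : Cot n → ℂ) : Prop :=
  ContDiffOn ℝ ∞ τ (cotangentMinusZero U) ∧
  ∀ x ∈ U, ∀ ξ : Base n, ξ ≠ 0 → ∀ t : ℝ, 0 < t → τ (x, t • ξ) = (t : ℂ) ^ z * τ (x, ξ)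

/-- `σ ∼ ∑_{i ≥ 0} χ s_i` with `s_i` positively homogeneous of degree `m - i`: the symbol `σ` has
order `Re m`, and for every `N` the remainder `σ - ∑_{i ≤ N} χ s_i` is a symbol of order
`Re m - N - 1`. -/
def HasExpansion {n : ℕ} (U : Set (Base n)) (χ : Cot n → ℂ) (m : ℂ) (σ : Cot n → ℂ)
    (s : ℕ → Cot n → ℂ) : Prop :=
  IsSymbol U m.re σ ∧
  (∀ i : ℕ, IsPosHomogeneous U (m - i) (s i)) ∧
  ∀ N : ℕ, IsSymbol U (m.re - N - 1) fun p => σ p - ∑ i ∈ Finset.range (N + 1), χ p * s i p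

/-- `σ ∈ CS^m(U)`: a classical symbol of complex order `m`. -/
def IsClassical {n : ℕ} (U : Set (Base n)) (χ : Cot n → ℂ) (m : ℂ) (σ : Cot n → ℂ) : Prop :=
  ∃ s : ℕ → Cot n → ℂ, HasExpansion U χ m σ s

/-- `τ` is the homogeneous component `σ_z` of degree `z` of an element `σ` of `CS(U)`, i.e. of a
finite sum of classical symbols `σ_i` of orders `m_i`: it is the sum of those terms of the
expansions of the `σ_i` whose degree `m_i - j` equals `z`. -/
def IsComponent {n : ℕ} (U : Set (Base n)) (χ : Cot n → ℂ) (z : ℂ) (σ τ : Cot n → ℂ) : Prop :=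
  ∃ (r : ℕ) (m : Fin r → ℂ) (f : Fin r → Cot n → ℂ) (s : Fin r → ℕ → Cot n → ℂ),
    (∀ i, HasExpansion U χ (m i) (f i) (s i)) ∧
    (∀ p ∈ cotangent U, σ p = ∑ i, f i p) ∧
    ∀ p ∈ cotangentMinusZero U, τ p = ∑ i, ∑ᶠ (j : ℕ) (_ : m i - j = z), s i j p

open Classical in
/-- The homogeneous component `σ_z` of degree `z` of `σ ∈ CS(U)`. It exists for every such `σ`,
and its values on `T^*U - {0}` are determined by `σ`, asymptotic expansions being unique. -/
def component {n : ℕ} (U : Set (Base n)) (χ : Cot n → ℂ) (z : ℂ) (σ : Cot n → ℂ) : Cot n → ℂ :=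
  if h : ∃ τ, IsComponent U χ z σ τ then h.choose else 0

/-! ### Symbol valued forms -/

/-- Complex valued differential forms of degree `k`. -/
abbrev KForm (n k : ℕ) : Type := Cot n → Cot n [⋀^Fin k]→L[ℝ] ℂ

/-- Differential forms of mixed degree; `α k` is the part of degree `k`
(which is zero for `k > 2n`). -/
abbrev Form (n : ℕ) : Type := (k : ℕ) → KForm n k

/-- The coefficient `η_{I,J}` in `η = ∑ η_{I,J} dx_I ∧ dξ_J`, where `|I| + |J| = k`: the value of
`η` on the vectors `∂/∂x_i` (`i ∈ I`, increasing) followed by `∂/∂ξ_j` (`j ∈ J`, increasing). -/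
def coeff {n k : ℕ} (η : KForm n k) (I J : Finset (Fin n)) (h : k = I.card + J.card) :
    Cot n → ℂ :=
  fun p => η p fun a =>
    Fin.append (fun b => coordVec (Sum.inl (I.orderEmbOfFin rfl b)))
      (fun b => coordVec (Sum.inr (J.orderEmbOfFin rfl b))) (Fin.cast h a)

/-- `η ∈ Ω^k CS^m(U)`: each coefficient `η_{I,J}` lies in `CS^{m-|J|}(U)`. -/
def IsClassicalForm {n k : ℕ} (U : Set (Base n)) (χ : Cot n → ℂ) (m : ℂ) (η : KForm n k) : Prop :=
  ∀ (I J : Finset (Fin n)) (h : k = I.card + J.card),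
    IsClassical U χ (m - (J.card : ℂ)) (coeff η I J h)

/-- `Ω^k CS(U)`: the linear span of the union of the `Ω^k CS^m(U)`, `m ∈ ℂ`. -/
def classicalKForms {n : ℕ} (U : Set (Base n)) (χ : Cot n → ℂ) (k : ℕ) :
    Submodule ℂ (KForm n k) :=
  Submodule.span ℂ (⋃ m : ℂ, {η | IsClassicalForm U χ m η})

/-- `Ω CS(U)`, the direct sum of the `Ω^k CS(U)`. -/
def classicalForms {n : ℕ} (U : Set (Base n)) (χ : Cot n → ℂ) : Submodule ℂ (Form n) :=
  Submodule.pi Set.univ (classicalKForms U χ)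

/-- The form has compact support in `U`: it vanishes at `(x, ξ) ∈ T^*U` for `x` outside some
compact subset of `U`. -/
def CompactlySupported {n : ℕ} (U : Set (Base n)) (α : Form n) : Prop :=
  ∃ K : Set (Base n), IsCompact K ∧ K ⊆ U ∧
    ∀ p ∈ cotangent U, p.1 ∉ K → ∀ k : ℕ, α k p = 0

/-- Exterior differentiation on `T^*U`. -/
def extD {n : ℕ} (α : Form n) : Form n
  | 0 => 0
  | k + 1 => extDeriv (α k)

/-! ### The Wodzicki residue -/

/-- The residue density `res_x(σ) = ∫_{|ξ|=1} σ_{-n}(x, ξ) d_Sξ` of `σ ∈ CS(U)`. The form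
`d_Sξ = ∑ (-1)^{i+1} ξ_i dξ_1 ∧ ⋯ (no dξ_i) ⋯ ∧ dξ_n` restricts to the unit sphere as its surface
measure, which is `volume.toSphere`. -/
def resDensity {n : ℕ} (U : Set (Base n)) (χ : Cot n → ℂ) (σ : Cot n → ℂ) (x : Base n) : ℂ :=
  ∫ θ : Metric.sphere (0 : Base n) 1, component U χ (-(n : ℂ)) σ (x, (θ : Base n))
    ∂((volume : Measure (Base n)).toSphere)

/-- The coefficient of `dx_1 ∧ ⋯ ∧ dx_n ∧ dξ_1 ∧ ⋯ ∧ dξ_n` in a form of mixed degree. -/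
def topCoeff {n : ℕ} (α : Form n) : Cot n → ℂ :=
  coeff (α ((Finset.univ : Finset (Fin n)).card + (Finset.univ : Finset (Fin n)).card))
    Finset.univ Finset.univ rfl

/-- The extended Wodzicki residue of a compactly supported form: the residue
`∫_U res_x dx` of the coefficient with `|I| = |J| = n`; other coefficients do not contribute. -/
def res {n : ℕ} (U : Set (Base n)) (χ : Cot n → ℂ) (α : Form n) : ℂ :=
  ∫ x in U, resDensity U χ (topCoeff α) x

/-- The function `(x, θ) ↦ (α_{I,J})_{-n}(x, θ)`, `|I| = |J| = n`, is integrable on the cosphere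
bundle `S^*U`, so that the integrals in `res` converge. -/
def ResIntegrable {n : ℕ} (U : Set (Base n)) (χ : Cot n → ℂ) (α : Form n) : Prop :=
  Integrable
    (fun q : Base n × Metric.sphere (0 : Base n) 1 =>
      component U χ (-(n : ℂ)) (topCoeff α) (q.1, (q.2 : Base n)))
    (((volume : Measure (Base n)).restrict U).prod (volume : Measure (Base n)).toSphere)

end Wodzicki

end

/-! By the coordinate formula for the exterior derivative, the top coefficient of `extD β` is an
alternating sum of first partial derivatives of coefficients of `β`. Expansions may be
differentiated term by term: ∂/∂x_i keeps degrees and ∂/∂ξ_j lowers them by one. So the component of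
degree -n is an alternating sum of derivatives of components τ of coefficients of `β`, where τ has
degree -n under a base derivative and 1 - n under a fibre derivative (`IsComponent.pderiv`).

Each summand integrates to zero over the cosphere bundle. For a base derivative, τ has compact
support in x, and the integral over U already vanishes. For a fibre derivative, the integral over
each unit sphere vanishes (`integral_toSphere_fderiv_eq_zero`): the derivative of ψ(|ξ|) τ, with ψ a
radial cut-off, has integral zero over ℝⁿ, and polar coordinates turn this into the sphere integral
of ∂τ times a positive number, plus a multiple of ∫ ψ' = 0.

Since `component` is defined by a choice of decomposition, components must be shown to be unique.
Along rays this becomes the asymptotic independence of complex powers of t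
(`eq_zero_of_sum_cpow_isLittleO`). The same argument shows that components inherit compact support
from the symbol. -/

open scoped ContDiff
open MeasureTheory
noncomputable section
namespace Wodzicki

/-! ### Coordinate derivatives. -/

variable {n : ℕ} {U : Set (Base n)}

/-- The partial derivative of a function on `T^*ℝⁿ` in a coordinate direction. -/
def pderiv (c : Fin n ⊕ Fin n) (σ : Cot n → ℂ) : Cot n → ℂ :=
  fun p => fderiv ℝ σ p (coordVec c)

/-- The amount by which `pderiv c` lowers the order of a symbol. -/
def fiberWeight (c : Fin n ⊕ Fin n) : ℕ := if c.isRight then 1 else 0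

theorem isOpen_cotangent (hU : IsOpen U) : IsOpen (cotangent U) :=
  hU.preimage continuous_fst

theorem isOpen_cotangentMinusZero (hU : IsOpen U) : IsOpen (cotangentMinusZero U) :=
  (hU.preimage continuous_fst).inter (isOpen_compl_singleton.preimage continuous_snd)

theorem pderiv_congr {V : Set (Cot n)} (hV : IsOpen V) {σ τ : Cot n → ℂ} (h : Set.EqOn σ τ V)
    (c : Fin n ⊕ Fin n) : Set.EqOn (pderiv c σ) (pderiv c τ) V := fun p hp => by
  unfold pderiv
  rw [(h.eventuallyEq_of_mem (hV.mem_nhds hp)).fderiv_eq]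

theorem contDiffOn_pderiv {V : Set (Cot n)} (hV : IsOpen V) {σ : Cot n → ℂ}
    (h : ContDiffOn ℝ ∞ σ V) (c : Fin n ⊕ Fin n) : ContDiffOn ℝ ∞ (pderiv c σ) V :=
  (h.fderiv_of_isOpen hV (m := ∞) (by simp)).clm_apply contDiffOn_const

theorem differentiableAt_of_contDiffOn {F : Type*} [NormedAddCommGroup F] [NormedSpace ℝ F]
    {V : Set (Cot n)} (hV : IsOpen V) {σ : Cot n → F}
    (h : ContDiffOn ℝ ∞ σ V) {p : Cot n} (hp : p ∈ V) : DifferentiableAt ℝ σ p :=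
  (h.contDiffAt (hV.mem_nhds hp)).differentiableAt (by simp)

theorem pderiv_sub {σ τ : Cot n → ℂ} {p : Cot n} (hσ : DifferentiableAt ℝ σ p)
    (hτ : DifferentiableAt ℝ τ p) (c : Fin n ⊕ Fin n) :
    pderiv c (fun p => σ p - τ p) p = pderiv c σ p - pderiv c τ p := by
  unfold pderiv
  rw [fderiv_fun_sub hσ hτ]; rfl

theorem pderiv_mul {σ τ : Cot n → ℂ} {p : Cot n} (hσ : DifferentiableAt ℝ σ p)
    (hτ : DifferentiableAt ℝ τ p) (c : Fin n ⊕ Fin n) :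
    pderiv c (fun p => σ p * τ p) p = pderiv c σ p * τ p + σ p * pderiv c τ p := by
  unfold pderiv
  rw [fderiv_fun_mul hσ hτ]
  simp [mul_comm, add_comm]

theorem pderiv_sum {ι : Type*} (s : Finset ι) {f : ι → Cot n → ℂ} {p : Cot n}
    (hf : ∀ i ∈ s, DifferentiableAt ℝ (f i) p) (c : Fin n ⊕ Fin n) :
    pderiv c (fun p => ∑ i ∈ s, f i p) p = ∑ i ∈ s, pderiv c (f i) p := by
  unfold pderiv
  rw [fderiv_fun_sum hf, sum_apply]

theorem pderiv_of_eqOn_zero {V : Set (Cot n)} (hV : IsOpen V) {σ : Cot n → ℂ}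
    (h : ∀ p ∈ V, σ p = 0) (c : Fin n ⊕ Fin n) : ∀ p ∈ V, pderiv c σ p = 0 := fun p hp => by
  rw [pderiv_congr hV (τ := fun _ => 0) h c hp]
  simp [pderiv]

/-- `pderiv c` is `fderiv` followed by evaluation at a fixed vector, a continuous linear map, which
commutes with iterated differentiation. The innermost derivative occupies the last slot. -/
theorem iteratedFDeriv_pderiv {V : Set (Cot n)} (hV : IsOpen V) {σ : Cot n → ℂ}
    (h : ContDiffOn ℝ ∞ σ V) {p : Cot n} (hp : p ∈ V) (c : Fin n ⊕ Fin n) (k : ℕ)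
    (v : Fin k → Cot n) :
    iteratedFDeriv ℝ k (pderiv c σ) p v =
      iteratedFDeriv ℝ (k + 1) σ p (Fin.snoc (α := fun _ => Cot n) v (coordVec c)) := by
  have hd : ContDiffAt ℝ ∞ (fderiv ℝ σ) p :=
    (h.fderiv_of_isOpen hV (m := ∞) (by simp)).contDiffAt (hV.mem_nhds hp)
  rw [iteratedFDeriv_succ_apply_right, Fin.init_snoc, Fin.snoc_last]
  have := (ContinuousLinearMap.apply ℝ ℂ (coordVec c)).iteratedFDeriv_comp_left hd (i := k)
    (by exact_mod_cast le_top)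
  exact congrArg (fun L => L v) this

/-! ### Symbol classes. -/

namespace IsSymbol

variable {m : ℝ} {σ τ : Cot n → ℂ}

theorem congr (hU : IsOpen U) (h : IsSymbol U m σ) (hστ : Set.EqOn σ τ (cotangent U)) :
    IsSymbol U m τ := by
  refine ⟨h.1.congr fun p hp => (hστ hp).symm, fun K hK hKU k c => ?_⟩
  obtain ⟨C, hC⟩ := h.2 K hK hKU k c
  refine ⟨C, fun x hx ξ => ?_⟩
  have hmem : (x, ξ) ∈ cotangent U := hKU hx
  rw [← ((hστ.eventuallyEq_of_mem ((isOpen_cotangent hU).mem_nhds hmem)).iteratedFDeriv ℝ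
    k).eq_of_nhds]
  exact hC x hx ξ

theorem add (hU : IsOpen U) (hσ : IsSymbol U m σ) (hτ : IsSymbol U m τ) :
    IsSymbol U m fun p => σ p + τ p := by
  refine ⟨hσ.1.add hτ.1, fun K hK hKU k c => ?_⟩
  obtain ⟨C, hC⟩ := hσ.2 K hK hKU k c
  obtain ⟨D, hD⟩ := hτ.2 K hK hKU k c
  refine ⟨C + D, fun x hx ξ => ?_⟩
  have hmem : cotangent U ∈ nhds (x, ξ) := (isOpen_cotangent hU).mem_nhds (hKU hx)
  have h1 := (hσ.1.contDiffAt hmem).of_le (m := k) (by exact_mod_cast le_top)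
  have h2 := (hτ.1.contDiffAt hmem).of_le (m := k) (by exact_mod_cast le_top)
  rw [show (fun p => σ p + τ p) = σ + τ from rfl, iteratedFDeriv_add_apply h1 h2,
    add_apply, add_mul]
  exact (norm_add_le _ _).trans (add_le_add (hC x hx ξ) (hD x hx ξ))

theorem const_mul (hU : IsOpen U) (hσ : IsSymbol U m σ) (a : ℂ) :
    IsSymbol U m fun p => a * σ p := by
  refine ⟨contDiffOn_const.mul hσ.1, fun K hK hKU k c => ?_⟩
  obtain ⟨C, hC⟩ := hσ.2 K hK hKU k c
  refine ⟨‖a‖ * C, fun x hx ξ => ?_⟩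
  have hmem : cotangent U ∈ nhds (x, ξ) := (isOpen_cotangent hU).mem_nhds (hKU hx)
  have h1 := (hσ.1.contDiffAt hmem).of_le (m := k) (by exact_mod_cast le_top)
  have := iteratedFDeriv_const_smul_apply (a := a) h1
  rw [show (fun p => a * σ p) = a • σ from rfl, this, smul_apply,
    norm_smul, mul_assoc]
  exact mul_le_mul_of_nonneg_left (hC x hx ξ) (norm_nonneg a)

theorem pderiv (hU : IsOpen U) (hσ : IsSymbol U m σ) (c : Fin n ⊕ Fin n) :
    IsSymbol U (m - fiberWeight c) (pderiv c σ) := by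
  refine ⟨contDiffOn_pderiv (isOpen_cotangent hU) hσ.1 c, fun K hK hKU k v => ?_⟩
  obtain ⟨C, hC⟩ := hσ.2 K hK hKU (k + 1) (Fin.snoc (α := fun _ => Fin n ⊕ Fin n) v c)
  refine ⟨C, fun x hx ξ => ?_⟩
  rw [iteratedFDeriv_pderiv (isOpen_cotangent hU) hσ.1 (hKU hx)]
  convert hC x hx ξ using 3
  · ext1 i
    refine Fin.lastCases ?_ (fun i => ?_) i <;> simp
  -- Appending `c` to the word raises the number of fibre derivatives by `fiberWeight c`, which is
  -- the drop in order.
  · simp only [Finset.card_filter, Fin.sum_univ_castSucc, Fin.snoc_castSucc, Fin.snoc_last,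
      fiberWeight, Nat.cast_add]
    ring

/-- A smooth function which vanishes for large `ξ` is a symbol of every order. -/
theorem of_eq_zero_of_one_lt (hU : IsOpen U) (hσ : ContDiffOn ℝ ∞ σ (cotangent U))
    (h0 : ∀ x ∈ U, ∀ ξ : Base n, 1 < ‖ξ‖ → σ (x, ξ) = 0) (m : ℝ) : IsSymbol U m σ := by
  refine ⟨hσ, fun K hK hKU k c => ?_⟩
  set b : ℝ := ((Finset.univ.filter fun i => (c i).isRight).card : ℝ)
  -- On the compact set `K` × unit ball the quotient by the weight is continuous, hence bounded; for
  -- `1 < ‖ξ‖`, an open condition, all derivatives vanish.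
  have hcont : ContinuousOn (fun p : Cot n => ‖iteratedFDeriv ℝ k σ p fun i => coordVec (c i)‖ /
      (1 + ‖p.2‖) ^ (m - b)) (K ×ˢ Metric.closedBall 0 1) := by
    have h1 : ContinuousOn (iteratedFDeriv ℝ k σ) (cotangent U) := fun p hp =>
      (((hσ.contDiffAt ((isOpen_cotangent hU).mem_nhds hp)).iteratedFDeriv_right (m := 0) (i := k)
        (by simp; exact_mod_cast le_top)).continuousAt).continuousWithinAt
    have h2 : ContinuousOn (fun p => iteratedFDeriv ℝ k σ p fun i => coordVec (c i))
        (K ×ˢ Metric.closedBall 0 1) :=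
      ((ContinuousMultilinearMap.apply ℝ (fun _ : Fin k => Cot n) ℂ
        fun i => coordVec (c i)).continuous.comp_continuousOn h1).mono fun p hp => hKU hp.1
    refine h2.norm.div (Continuous.continuousOn ?_) fun p _ => ?_
    · exact (by fun_prop : Continuous fun p : Cot n => 1 + ‖p.2‖).rpow_const fun p =>
        Or.inl (by positivity)
    · positivity
  obtain ⟨C, hC⟩ := (hK.prod (isCompact_closedBall (0 : Base n) 1)).bddAbove_image hcont
  refine ⟨max C 0, fun x hx ξ => ?_⟩
  have hpos : 0 < (1 + ‖ξ‖) ^ (m - b) := by positivity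
  rcases le_or_gt ‖ξ‖ 1 with hξ | hξ
  · have := hC (Set.mem_image_of_mem _ (show (x, ξ) ∈ K ×ˢ Metric.closedBall 0 1 from
      ⟨hx, by simpa using hξ⟩))
    exact (div_le_iff₀ hpos).1 (this.trans (le_max_left _ _))
  · have hopen : IsOpen {p : Cot n | p.1 ∈ U ∧ 1 < ‖p.2‖} :=
      (hU.preimage continuous_fst).inter
        (isOpen_lt continuous_const (continuous_norm.comp continuous_snd))
    have he : σ =ᶠ[nhds (x, ξ)] fun _ => 0 :=
      Filter.eventually_of_mem (hopen.mem_nhds ⟨hKU hx, hξ⟩) fun p hp => h0 p.1 hp.1 p.2 hp.2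
    rw [(he.iteratedFDeriv ℝ k).eq_of_nhds]
    simp only [iteratedFDeriv_fun_zero, Pi.zero_apply, zero_apply, norm_zero]
    positivity

theorem of_eqOn_zero (hU : IsOpen U) (h0 : ∀ p ∈ cotangent U, σ p = 0) (m : ℝ) :
    IsSymbol U m σ :=
  of_eq_zero_of_one_lt hU (contDiffOn_const (c := 0) |>.congr h0) (fun x hx _ _ => h0 (x, _) hx) m

end IsSymbol

/-! ### Positively homogeneous functions. -/

variable {n : ℕ} {U : Set (Base n)} {χ : Cot n → ℂ}

theorem IsPosHomogeneous.congr {z : ℂ} {τ τ' : Cot n → ℂ} (h : IsPosHomogeneous U z τ)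
    (he : Set.EqOn τ τ' (cotangentMinusZero U)) : IsPosHomogeneous U z τ' := by
  refine ⟨h.1.congr fun p hp => (he hp).symm, fun x hx ξ hξ t ht => ?_⟩
  have h1 : (x, ξ) ∈ cotangentMinusZero U := ⟨hx, hξ⟩
  have h2 : (x, t • ξ) ∈ cotangentMinusZero U := ⟨hx, smul_ne_zero ht.ne' hξ⟩
  rw [← he h1, ← he h2]
  exact h.2 x hx ξ hξ t ht

theorem IsPosHomogeneous.add {z : ℂ} {τ τ' : Cot n → ℂ} (h : IsPosHomogeneous U z τ)
    (h' : IsPosHomogeneous U z τ') : IsPosHomogeneous U z fun p => τ p + τ' p :=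
  ⟨h.1.add h'.1, fun x hx ξ hξ t ht => by
    simp only [h.2 x hx ξ hξ t ht, h'.2 x hx ξ hξ t ht, mul_add]⟩

theorem IsPosHomogeneous.const_mul {z : ℂ} {τ : Cot n → ℂ} (h : IsPosHomogeneous U z τ) (a : ℂ) :
    IsPosHomogeneous U z fun p => a * τ p :=
  ⟨contDiffOn_const.mul h.1, fun x hx ξ hξ t ht => by
    simp only [h.2 x hx ξ hξ t ht, mul_left_comm]⟩

theorem isPosHomogeneous_zero (z : ℂ) : IsPosHomogeneous U z fun _ => 0 :=
  ⟨contDiffOn_const, by simp⟩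

/-- Differentiate `τ ∘ A = t ^ z * τ`, where `A (x, ξ) = (x, t • ξ)`. The map `A` fixes ∂/∂x_i and
scales ∂/∂ξ_j by `t`; dividing by this `t` lowers the degree by one. -/
theorem IsPosHomogeneous.pderiv (hU : IsOpen U) {z : ℂ} {τ : Cot n → ℂ}
    (h : IsPosHomogeneous U z τ) (c : Fin n ⊕ Fin n) :
    IsPosHomogeneous U (z - fiberWeight c) (pderiv c τ) := by
  have hV := isOpen_cotangentMinusZero hU
  refine ⟨contDiffOn_pderiv hV h.1 c, fun x hx ξ hξ t ht => ?_⟩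
  have h1 : (x, ξ) ∈ cotangentMinusZero U := ⟨hx, hξ⟩
  have h2 : (x, t • ξ) ∈ cotangentMinusZero U := ⟨hx, smul_ne_zero ht.ne' hξ⟩
  let A : Cot n →L[ℝ] Cot n :=
    (ContinuousLinearMap.fst ℝ _ _).prod (t • ContinuousLinearMap.snd ℝ _ _)
  have hA : ∀ p : Cot n, A p = (p.1, t • p.2) := fun p => rfl
  have he : (fun p => τ (A p)) =ᶠ[nhds (x, ξ)] fun p => (t : ℂ) ^ z * τ p :=
    Filter.eventually_of_mem (hV.mem_nhds h1) fun p hp => h.2 p.1 hp.1 p.2 hp.2 t ht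
  have hd1 : HasFDerivAt τ (fderiv ℝ τ (x, t • ξ)) (A (x, ξ)) :=
    (differentiableAt_of_contDiffOn hV h.1 h2).hasFDerivAt
  have hd2 := (differentiableAt_of_contDiffOn hV h.1 h1).hasFDerivAt
  have hcomp := (hd1.comp (x, ξ) A.hasFDerivAt).unique
    ((hd2.const_mul ((t : ℂ) ^ z)).congr_of_eventuallyEq he)
  have hv := congrArg (fun L => L (coordVec c)) hcomp
  have ht' : (t : ℂ) ≠ 0 := by exact_mod_cast ht.ne'
  simp only [ContinuousLinearMap.comp_apply, smul_apply, smul_eq_mul] at hv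
  unfold Wodzicki.pderiv
  cases c with
  | inl i =>
    have : A (coordVec (Sum.inl i)) = coordVec (Sum.inl i) := by simp [hA, coordVec]
    rw [this] at hv
    simpa [fiberWeight] using hv
  | inr j =>
    have : A (coordVec (Sum.inr j)) = t • coordVec (Sum.inr j) := by simp [hA, coordVec]
    rw [this, map_smul, Complex.real_smul] at hv
    simp only [fiberWeight, Sum.isRight_inr, if_true, Nat.cast_one]
    rw [Complex.cpow_sub _ _ ht', Complex.cpow_one, div_mul_eq_mul_div, ← hv,
      mul_div_cancel_left₀ _ ht']

/-! ### Classical symbols -/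

namespace HasExpansion

variable {m : ℂ} {σ τ : Cot n → ℂ} {s u : ℕ → Cot n → ℂ}

theorem congr (hU : IsOpen U) (h : HasExpansion U χ m σ s) (he : Set.EqOn σ τ (cotangent U)) :
    HasExpansion U χ m τ s :=
  ⟨h.1.congr hU he, h.2.1, fun N => (h.2.2 N).congr hU fun p hp => by simp only [he hp]⟩

theorem add (hU : IsOpen U) (h : HasExpansion U χ m σ s) (h' : HasExpansion U χ m τ u) :
    HasExpansion U χ m (fun p => σ p + τ p) fun i p => s i p + u i p :=
  ⟨h.1.add hU h'.1, fun i => (h.2.1 i).add (h'.2.1 i), fun N =>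
    ((h.2.2 N).add hU (h'.2.2 N)).congr hU fun p _ => by
      simp only [mul_add, Finset.sum_add_distrib]; ring⟩

theorem const_mul (hU : IsOpen U) (h : HasExpansion U χ m σ s) (a : ℂ) :
    HasExpansion U χ m (fun p => a * σ p) fun i p => a * s i p :=
  ⟨h.1.const_mul hU a, fun i => (h.2.1 i).const_mul a, fun N =>
    ((h.2.2 N).const_mul hU a).congr hU fun p _ => by
      simp only [mul_sub, Finset.mul_sum, mul_left_comm]⟩

theorem of_eqOn_zero (hU : IsOpen U) (h0 : ∀ p ∈ cotangent U, σ p = 0) (m : ℂ) :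
    HasExpansion U χ m σ fun _ _ => 0 :=
  ⟨.of_eqOn_zero hU h0 _, fun _ => isPosHomogeneous_zero _, fun N =>
    .of_eqOn_zero hU (fun p hp => by simp [h0 p hp]) _⟩

/-- Both `χ` and its derivatives vanish for `‖ξ‖ < 1 / 2`, which hides the singularity of `τ` at the
zero section. -/
theorem contDiffOn_pderiv_cutoff_mul (hU : IsOpen U) (hχ : IsCutoff U χ) {τ : Cot n → ℂ}
    (hτ : ContDiffOn ℝ ∞ τ (cotangentMinusZero U)) (c : Fin n ⊕ Fin n) :
    ContDiffOn ℝ ∞ (fun p => Wodzicki.pderiv c χ p * τ p) (cotangent U) ∧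
      ContDiffOn ℝ ∞ (fun p => χ p * τ p) (cotangent U) := by
  have hV := isOpen_cotangentMinusZero hU
  have hW : IsOpen {p : Cot n | p.1 ∈ U ∧ ‖p.2‖ < 1 / 2} :=
    (hU.preimage continuous_fst).inter
      (isOpen_lt (continuous_norm.comp continuous_snd) continuous_const)
  have hχ0 : ∀ p ∈ {p : Cot n | p.1 ∈ U ∧ ‖p.2‖ < 1 / 2}, χ p = 0 := fun p hp =>
    hχ.2.1 p.1 hp.1 p.2 hp.2.le
  have key : ∀ ψ : Cot n → ℂ, ContDiffOn ℝ ∞ ψ (cotangent U) →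
      (∀ p ∈ {p : Cot n | p.1 ∈ U ∧ ‖p.2‖ < 1 / 2}, ψ p = 0) →
      ContDiffOn ℝ ∞ (fun p => ψ p * τ p) (cotangent U) := by
    intro ψ hψ h0 p hp
    apply ContDiffAt.contDiffWithinAt
    by_cases hξ : p.2 = 0
    · have hpW : p ∈ {p : Cot n | p.1 ∈ U ∧ ‖p.2‖ < 1 / 2} := ⟨hp, by simp [hξ]⟩
      refine (contDiffAt_const (c := (0 : ℂ))).congr_of_eventuallyEq ?_
      exact Filter.eventually_of_mem (hW.mem_nhds hpW) fun q hq => by simp [h0 q hq]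
    · exact (hψ.contDiffAt ((isOpen_cotangent hU).mem_nhds hp)).mul
        (hτ.contDiffAt (hV.mem_nhds ⟨hp, hξ⟩))
  exact ⟨key _ (contDiffOn_pderiv (isOpen_cotangent hU) hχ.1 c) (pderiv_of_eqOn_zero hW hχ0 c),
    key χ hχ.1 hχ0⟩

/-- Differentiating `χ * s i` produces the extra term `pderiv c χ * s i`. It vanishes for `1 < ‖ξ‖`,
so it is a symbol of every order and can be absorbed in the remainder. -/
theorem pderiv (hU : IsOpen U) (hχ : IsCutoff U χ) (h : HasExpansion U χ m σ s)
    (c : Fin n ⊕ Fin n) :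
    HasExpansion U χ (m - fiberWeight c) (pderiv c σ) fun i => Wodzicki.pderiv c (s i) := by
  have hT := isOpen_cotangent hU
  have hV := isOpen_cotangentMinusZero hU
  refine ⟨by simpa using h.1.pderiv hU c, fun i => ?_, fun N => ?_⟩
  · convert (h.2.1 i).pderiv hU c using 1
    ring
  have hlarge : IsOpen {p : Cot n | p.1 ∈ U ∧ 1 < ‖p.2‖} :=
    (hU.preimage continuous_fst).inter
      (isOpen_lt continuous_const (continuous_norm.comp continuous_snd))
  have hdχ : ∀ p ∈ {p : Cot n | p.1 ∈ U ∧ 1 < ‖p.2‖}, Wodzicki.pderiv c χ p = 0 := fun p hp => by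
    rw [pderiv_congr hlarge (τ := fun _ => 1) (fun q hq => hχ.2.2 q.1 hq.1 q.2 hq.2.le) c hp]
    simp [Wodzicki.pderiv]
  have hsm : ContDiffOn ℝ ∞ (fun p => ∑ i ∈ Finset.range (N + 1),
      Wodzicki.pderiv c χ p * s i p) (cotangent U) :=
    ContDiffOn.sum fun i _ => (contDiffOn_pderiv_cutoff_mul hU hχ (h.2.1 i).1 c).1
  have herr := IsSymbol.of_eq_zero_of_one_lt hU hsm (fun x hx ξ hξ => Finset.sum_eq_zero
    fun i _ => by rw [hdχ (x, ξ) ⟨hx, hξ⟩, zero_mul]) ((m - fiberWeight c).re - N - 1)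
  have hrem := (h.2.2 N).pderiv hU c
  rw [show m.re - N - 1 - fiberWeight c = (m - fiberWeight c).re - N - 1 by simp; ring] at hrem
  refine (hrem.add hU herr).congr hU fun p hp => ?_
  have hd : ∀ i, DifferentiableAt ℝ (fun p => χ p * s i p) p := fun i =>
    differentiableAt_of_contDiffOn hT (contDiffOn_pderiv_cutoff_mul hU hχ (h.2.1 i).1 c).2 hp
  have hσ := differentiableAt_of_contDiffOn hT h.1.1 hp
  have hmul : ∀ i, Wodzicki.pderiv c (fun p => χ p * s i p) p =
      Wodzicki.pderiv c χ p * s i p + χ p * Wodzicki.pderiv c (s i) p := fun i => by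
    -- On the zero section `s i` need not be differentiable, but `χ` is zero nearby and both sides
    -- vanish.
    by_cases hξ : p.2 = 0
    · have hW : IsOpen {p : Cot n | p.1 ∈ U ∧ ‖p.2‖ < 1 / 2} :=
        (hU.preimage continuous_fst).inter
          (isOpen_lt (continuous_norm.comp continuous_snd) continuous_const)
      have hpW : p ∈ {p : Cot n | p.1 ∈ U ∧ ‖p.2‖ < 1 / 2} := ⟨hp, by simp [hξ]⟩
      have hχ0 : ∀ p ∈ {p : Cot n | p.1 ∈ U ∧ ‖p.2‖ < 1 / 2}, χ p = 0 := fun p hp =>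
        hχ.2.1 p.1 hp.1 p.2 hp.2.le
      rw [pderiv_of_eqOn_zero hW (fun q hq => by simp [hχ0 q hq]) c p hpW,
        pderiv_of_eqOn_zero hW hχ0 c p hpW, hχ0 p hpW]
      simp
    · exact pderiv_mul (differentiableAt_of_contDiffOn hT hχ.1 hp)
        (differentiableAt_of_contDiffOn hV (h.2.1 i).1 ⟨hp, hξ⟩) c
  simp only
  rw [pderiv_sub hσ (DifferentiableAt.fun_sum fun i _ => hd i), pderiv_sum _ fun i _ => hd i]
  simp only [hmul, Finset.sum_add_distrib]
  ring

end HasExpansion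

namespace IsClassical

variable {m : ℂ} {σ τ : Cot n → ℂ}

theorem congr (hU : IsOpen U) (h : IsClassical U χ m σ) (he : Set.EqOn σ τ (cotangent U)) :
    IsClassical U χ m τ :=
  h.imp fun _ hs => hs.congr hU he

theorem of_eqOn_zero (hU : IsOpen U) (h0 : ∀ p ∈ cotangent U, σ p = 0) (m : ℂ) :
    IsClassical U χ m σ :=
  ⟨_, HasExpansion.of_eqOn_zero hU h0 m⟩

theorem add (hU : IsOpen U) (h : IsClassical U χ m σ) (h' : IsClassical U χ m τ) :
    IsClassical U χ m fun p => σ p + τ p :=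
  let ⟨_, hs⟩ := h
  let ⟨_, hu⟩ := h'
  ⟨_, hs.add hU hu⟩

theorem const_mul (hU : IsOpen U) (h : IsClassical U χ m σ) (a : ℂ) :
    IsClassical U χ m fun p => a * σ p :=
  let ⟨_, hs⟩ := h
  ⟨_, hs.const_mul hU a⟩

theorem sum (hU : IsOpen U) {ι : Type*} (t : Finset ι) {f : ι → Cot n → ℂ}
    (h : ∀ i ∈ t, IsClassical U χ m (f i)) : IsClassical U χ m fun p => ∑ i ∈ t, f i p := by
  classical
  induction t using Finset.induction_on with
  | empty => exact of_eqOn_zero hU (by simp) m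
  | insert a t ha ih =>
    refine ((h a (by simp)).add hU (ih fun i hi => h i (by simp [hi]))).congr hU fun p _ => ?_
    simp [Finset.sum_insert ha]

theorem pderiv (hU : IsOpen U) (hχ : IsCutoff U χ) (h : IsClassical U χ m σ)
    (c : Fin n ⊕ Fin n) : IsClassical U χ (m - fiberWeight c) (pderiv c σ) :=
  let ⟨_, hs⟩ := h
  ⟨_, hs.pderiv hU hχ c⟩

end IsClassical

/-! ### Homogeneous components -/

/-- The term of degree `z` in the family `s` of terms of degrees `m - j`. -/
def termOfDegree (m : ℂ) (s : ℕ → Cot n → ℂ) (z : ℂ) : Cot n → ℂ :=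
  fun p => ∑ᶠ (j : ℕ) (_ : m - j = z), s j p

theorem termOfDegree_eq {m : ℂ} (s : ℕ → Cot n → ℂ) {z : ℂ} {j : ℕ} (h : m - j = z) :
    termOfDegree m s z = s j := by
  ext p
  unfold termOfDegree
  rw [finsum_eq_single _ j, finsum_eq_if, if_pos h]
  intro i hi
  rw [finsum_eq_if, if_neg]
  intro hi'
  rw [← h] at hi'
  exact hi (by exact_mod_cast sub_right_injective hi')

theorem termOfDegree_eq_zero {m : ℂ} (s : ℕ → Cot n → ℂ) {z : ℂ} (h : ∀ j : ℕ, m - j ≠ z) :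
    termOfDegree m s z = fun _ => 0 := by
  ext p
  simp [termOfDegree, h]

theorem IsPosHomogeneous.termOfDegree {m : ℂ} {s : ℕ → Cot n → ℂ}
    (h : ∀ i : ℕ, IsPosHomogeneous U (m - i) (s i)) (z : ℂ) :
    IsPosHomogeneous U z (termOfDegree m s z) := by
  by_cases hz : ∃ j : ℕ, m - j = z
  · obtain ⟨j, hj⟩ := hz
    rw [termOfDegree_eq s hj, ← hj]
    exact h j
  · push Not at hz
    rw [termOfDegree_eq_zero s hz]
    exact isPosHomogeneous_zero z

/-- Order and degree shift by the same amount, so both sides select the same index `j`, or none. -/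
theorem termOfDegree_pderiv (m : ℂ) (s : ℕ → Cot n → ℂ) (z : ℂ) (c : Fin n ⊕ Fin n) :
    termOfDegree (m - fiberWeight c) (fun j => pderiv c (s j)) (z - fiberWeight c) =
      pderiv c (termOfDegree m s z) := by
  by_cases hz : ∃ j : ℕ, m - j = z
  · obtain ⟨j, hj⟩ := hz
    rw [termOfDegree_eq s hj, termOfDegree_eq _ (j := j) (by rw [← hj]; ring)]
  · push Not at hz
    rw [termOfDegree_eq_zero s hz, termOfDegree_eq_zero]
    · ext p; simp [pderiv]
    · intro j hj
      exact hz j (by linear_combination hj)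

namespace IsComponent

variable {z : ℂ} {σ τ σ' τ' : Cot n → ℂ}

/-- Arbitrary finite index types let decompositions be joined over a disjoint union, without
renumbering. -/
theorem of_fintype {ι : Type*} [Fintype ι] {m : ι → ℂ} {f : ι → Cot n → ℂ}
    {s : ι → ℕ → Cot n → ℂ} (h : ∀ i, HasExpansion U χ (m i) (f i) (s i))
    (hσ : ∀ p ∈ cotangent U, σ p = ∑ i, f i p)
    (hτ : ∀ p ∈ cotangentMinusZero U, τ p = ∑ i, termOfDegree (m i) (s i) z p) :
    IsComponent U χ z σ τ := by
  let e := Fintype.equivFin ι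
  refine ⟨Fintype.card ι, m ∘ e.symm, f ∘ e.symm, s ∘ e.symm, fun i => h _, fun p hp => ?_,
    fun p hp => ?_⟩
  · rw [hσ p hp]
    exact (e.symm.sum_comp fun i => f i p).symm
  · rw [hτ p hp]
    exact (e.symm.sum_comp fun i => termOfDegree (m i) (s i) z p).symm

theorem add (h : IsComponent U χ z σ τ) (h' : IsComponent U χ z σ' τ') :
    IsComponent U χ z (fun p => σ p + σ' p) fun p => τ p + τ' p := by
  obtain ⟨r, m, f, s, h1, h2, h3⟩ := h
  obtain ⟨r', m', f', s', h1', h2', h3'⟩ := h'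
  refine of_fintype (ι := Fin r ⊕ Fin r') (m := Sum.elim m m') (f := Sum.elim f f')
    (s := Sum.elim s s') ?_ (fun p hp => ?_) fun p hp => ?_
  · rintro (i | i)
    exacts [h1 i, h1' i]
  · simp [h2 p hp, h2' p hp]
  · simp [h3 p hp, h3' p hp, termOfDegree]

theorem const_mul (hU : IsOpen U) (h : IsComponent U χ z σ τ) (a : ℂ) :
    IsComponent U χ z (fun p => a * σ p) fun p => a * τ p := by
  obtain ⟨r, m, f, s, h1, h2, h3⟩ := h
  refine of_fintype (fun i => (h1 i).const_mul hU a) (fun p hp => ?_) fun p hp => ?_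
  · rw [h2 p hp, Finset.mul_sum]
  · rw [h3 p hp, Finset.mul_sum]
    refine Finset.sum_congr rfl fun i _ => ?_
    change a * termOfDegree (m i) (s i) z p = _
    by_cases hz : ∃ j : ℕ, m i - j = z
    · obtain ⟨j, hj⟩ := hz
      rw [termOfDegree_eq _ hj, termOfDegree_eq _ hj]
    · push Not at hz
      rw [termOfDegree_eq_zero _ hz, termOfDegree_eq_zero _ hz, mul_zero]

theorem congr_left (h : IsComponent U χ z σ τ) (he : Set.EqOn σ σ' (cotangent U)) :
    IsComponent U χ z σ' τ := by
  obtain ⟨r, m, f, s, h1, h2, h3⟩ := h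
  exact ⟨r, m, f, s, h1, fun p hp => by rw [← he hp, h2 p hp], h3⟩

theorem zero : IsComponent U χ z (fun _ => 0) fun _ => 0 :=
  of_fintype (ι := Empty) (m := nofun) (f := nofun) (s := nofun) nofun (by simp) (by simp)

theorem sum {ι : Type*} (t : Finset ι) {f g : ι → Cot n → ℂ}
    (h : ∀ i ∈ t, IsComponent U χ z (f i) (g i)) :
    IsComponent U χ z (fun p => ∑ i ∈ t, f i p) fun p => ∑ i ∈ t, g i p := by
  classical
  induction t using Finset.induction_on with
  | empty => simpa using zero
  | insert a t ha ih =>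
    simp only [Finset.sum_insert ha]
    exact (h a (by simp)).add (ih fun i hi => h i (by simp [hi]))

theorem isPosHomogeneous (h : IsComponent U χ z σ τ) : IsPosHomogeneous U z τ := by
  obtain ⟨r, m, f, s, h1, h2, h3⟩ := h
  have key : ∀ t : Finset (Fin r), IsPosHomogeneous U z
      fun p => ∑ i ∈ t, termOfDegree (m i) (s i) z p := fun t => by
    induction t using Finset.induction_on with
    | empty => simpa using isPosHomogeneous_zero z
    | insert a t ha ih =>
      simp only [Finset.sum_insert ha]
      exact (IsPosHomogeneous.termOfDegree (h1 a).2.1 z).add ih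
  exact (key Finset.univ).congr fun p hp => (h3 p hp).symm

theorem pderiv (hU : IsOpen U) (hχ : IsCutoff U χ) (h : IsComponent U χ z σ τ)
    (c : Fin n ⊕ Fin n) :
    IsComponent U χ (z - fiberWeight c) (pderiv c σ) (Wodzicki.pderiv c τ) := by
  have hT := isOpen_cotangent hU
  have hV := isOpen_cotangentMinusZero hU
  obtain ⟨r, m, f, s, h1, h2, h3⟩ := h
  refine of_fintype (fun i => (h1 i).pderiv hU hχ c) (fun p hp => ?_) fun p hp => ?_
  · rw [pderiv_congr hT h2 c hp]
    exact pderiv_sum _ (fun i _ => differentiableAt_of_contDiffOn hT (h1 i).1.1 hp) c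
  · simp only [termOfDegree_pderiv]
    rw [pderiv_congr hV h3 c hp]
    exact pderiv_sum _ (fun i _ => differentiableAt_of_contDiffOn hV
      (IsPosHomogeneous.termOfDegree (h1 i).2.1 z).1 hp) c

end IsComponent

/-! ### Uniqueness of homogeneous components -/

open Asymptotics Filter in
-- Exponents may share a real part, so comparing growth does not separate them. Instead a scaling t
-- ↦ ut removes one exponent at a time; this changes the coefficients, which are therefore
-- quantified inside the induction.
theorem eq_zero_of_sum_cpow_isLittleO {R : ℝ} {z : ℂ} (hz : R ≤ z.re) (W : Finset ℂ) :
    ∀ (a : ℂ) (c : ℂ → ℂ), z ∉ W →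
      (fun t : ℝ => a * (t : ℂ) ^ z + ∑ w ∈ W, c w * (t : ℂ) ^ w) =o[atTop] (fun t : ℝ => t ^ R) →
      a = 0 := by
  induction W using Finset.induction_on with
  | empty =>
    intro a c _ h
    by_contra ha
    simp only [Finset.sum_empty, add_zero] at h
    have h1 : ∀ᶠ t : ℝ in atTop, ‖a * (t : ℂ) ^ z‖ ≤ ‖a‖ / 2 * ‖t ^ R‖ :=
      h.def (by positivity)
    obtain ⟨t, ht, ht1⟩ := (h1.and (eventually_ge_atTop 1)).exists
    have htpos : 0 < t := by linarith
    rw [norm_mul, Complex.norm_cpow_eq_rpow_re_of_pos htpos,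
      Real.norm_of_nonneg (Real.rpow_nonneg htpos.le R)] at ht
    have h2 : t ^ R ≤ t ^ z.re := Real.rpow_le_rpow_of_exponent_le ht1 hz
    have h3 : 0 < t ^ R := Real.rpow_pos_of_pos htpos R
    have h4 : 0 < ‖a‖ := norm_pos_iff.2 ha
    nlinarith
  | insert w₀ W hw₀ ih =>
    intro a c hzW h
    simp only [Finset.mem_insert, not_or] at hzW
    -- Take the relation at `u * t` minus `u ^ w₀` times the relation at `t`: the exponent `w₀`
    -- cancels and `a` is multiplied by `u ^ z - u ^ w₀`.
    have key : ∀ h : ℝ, 0 < h → a * ((h : ℂ) ^ z - (h : ℂ) ^ w₀) = 0 := by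
      intro u hu
      refine ih _ (fun w => c w * ((u : ℂ) ^ w - (u : ℂ) ^ w₀)) hzW.2 ?_
      have ht : Tendsto (fun t : ℝ => u * t) atTop atTop := tendsto_id.const_mul_atTop hu
      have h1 := h.comp_tendsto ht
      have h2 : ((fun t : ℝ => t ^ R) ∘ fun t => u * t) =O[atTop] fun t : ℝ => t ^ R := by
        refine IsBigO.of_bound (u ^ R) ?_
        filter_upwards [eventually_gt_atTop 0] with t htpos
        simp only [Function.comp]
        rw [Real.mul_rpow hu.le htpos.le, norm_mul, Real.norm_of_nonneg (Real.rpow_nonneg hu.le R)]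
      refine ((h1.trans_isBigO h2).sub (h.const_mul_left ((u : ℂ) ^ w₀))).congr' ?_ .rfl
      filter_upwards [eventually_gt_atTop 0] with t htpos
      have hm : ∀ w : ℂ, ((u * t : ℝ) : ℂ) ^ w = (u : ℂ) ^ w * (t : ℂ) ^ w := fun w => by
        rw [Complex.ofReal_mul, Complex.mul_cpow_ofReal_nonneg hu.le htpos.le]
      simp only [Function.comp, hm, Finset.sum_insert hw₀, mul_add, Finset.mul_sum, mul_sub,
        sub_mul, Finset.sum_sub_distrib]
      have e1 : ∑ w ∈ W, (u : ℂ) ^ w₀ * (c w * (t : ℂ) ^ w) =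
          ∑ w ∈ W, c w * (u : ℂ) ^ w₀ * (t : ℂ) ^ w :=
        Finset.sum_congr rfl fun w _ => by ring
      have e2 : ∑ w ∈ W, c w * ((u : ℂ) ^ w * (t : ℂ) ^ w) =
          ∑ w ∈ W, c w * (u : ℂ) ^ w * (t : ℂ) ^ w :=
        Finset.sum_congr rfl fun w _ => by ring
      rw [e1, e2]
      ring
    by_contra ha
    -- If `a ≠ 0`, putting `u = exp s` makes this exponential constant; its derivative at 0 then
    -- forces `z = w₀`.
    have hall : ∀ s : ℝ, Complex.exp (s * (z - w₀)) = 1 := fun s => by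
      have := key (Real.exp s) (Real.exp_pos s)
      have h0 := sub_eq_zero.1 ((mul_eq_zero.1 this).resolve_left ha)
      have hne : ((Real.exp s : ℝ) : ℂ) ≠ 0 := by exact_mod_cast (Real.exp_pos s).ne'
      have hlog : Complex.log ((Real.exp s : ℝ) : ℂ) = s := by
        rw [← Complex.ofReal_log (Real.exp_pos s).le, Real.log_exp]
      rw [Complex.cpow_def_of_ne_zero hne, Complex.cpow_def_of_ne_zero hne, hlog] at h0
      rw [mul_sub, Complex.exp_sub, h0, div_self (Complex.exp_ne_zero _)]
    have hd : HasDerivAt (fun s : ℝ => Complex.exp (s * (z - w₀)))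
        (Complex.exp ((0 : ℝ) * (z - w₀)) * (1 * (z - w₀))) 0 :=
      ((Complex.ofRealCLM.hasDerivAt (x := 0)).mul_const (z - w₀)).cexp
    have hc : HasDerivAt (fun s : ℝ => Complex.exp (s * (z - w₀))) 0 0 := by
      simp only [hall]
      exact hasDerivAt_const _ _
    have := hd.unique hc
    simp only [Complex.ofReal_zero, zero_mul, Complex.exp_zero, one_mul] at this
    exact hzW.1 (sub_eq_zero.1 this)

open Asymptotics Filter in
/-- In an asymptotic relation between complex powers, the coefficients belonging to the same
non-negligible exponent add up to zero. -/
theorem sum_coeff_eq_zero_of_isLittleO {ι : Type*} (F : Finset ι) (e c : ι → ℂ) {R : ℝ} {z : ℂ}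
    (hz : R ≤ z.re)
    (h : (fun t : ℝ => ∑ i ∈ F, c i * (t : ℂ) ^ e i) =o[atTop] fun t : ℝ => t ^ R) :
    ∑ i ∈ F with e i = z, c i = 0 := by
  classical
  refine eq_zero_of_sum_cpow_isLittleO hz ((F.filter fun i => e i ≠ z).image e) _
    (fun w => ∑ i ∈ (F.filter fun i => e i ≠ z) with e i = w, c i) (by simp) (h.congr_left ?_)
  intro t
  rw [← Finset.sum_filter_add_sum_filter_not F (fun i => e i = z)]
  congr 1
  · rw [Finset.sum_mul]
    exact Finset.sum_congr rfl fun i hi => by rw [(Finset.mem_filter.1 hi).2]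
  · rw [← Finset.sum_fiberwise_of_maps_to (t := (F.filter fun i => e i ≠ z).image e)
      (fun i hi => Finset.mem_image_of_mem e hi)]
    refine Finset.sum_congr rfl fun w _ => ?_
    rw [Finset.sum_mul]
    exact Finset.sum_congr rfl fun i hi => by rw [(Finset.mem_filter.1 hi).2]

open Asymptotics Filter in
theorem rpow_one_add_mul_isLittleO {μ R : ℝ} (hμ : μ < R) {a : ℝ} (ha : 0 < a) :
    (fun t : ℝ => (1 + t * a) ^ μ) =o[atTop] fun t : ℝ => t ^ R := by
  refine IsBigO.trans_isLittleO (g := fun t : ℝ => t ^ μ) ?_ ?_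
  swap
  · refine isLittleO_of_tendsto' ?_ ((tendsto_rpow_neg_atTop (sub_pos.2 hμ)).congr' ?_)
    · filter_upwards [eventually_gt_atTop 0] with t ht h
      exact absurd h (Real.rpow_pos_of_pos ht R).ne'
    · filter_upwards [eventually_gt_atTop 0] with t ht
      rw [neg_sub, Real.rpow_sub ht]
  -- For `t ≥ 1` one has `a * t ≤ 1 + t * a ≤ (1 + a) * t`; the upper bound serves `μ ≥ 0`, the
  -- lower one `μ ≤ 0`, and the constant covers both.
  refine IsBigO.of_bound (a ^ μ + (1 + a) ^ μ) ?_
  filter_upwards [eventually_ge_atTop 1] with t ht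
  have ht0 : 0 < t := by linarith
  rw [Real.norm_of_nonneg (by positivity), Real.norm_of_nonneg (by positivity), add_mul,
    ← Real.mul_rpow ha.le ht0.le, ← Real.mul_rpow (by positivity) ht0.le]
  rcases le_total 0 μ with h | h
  · refine (Real.rpow_le_rpow (by positivity) ?_ h).trans
      (le_add_of_nonneg_left (by positivity))
    nlinarith
  · refine (Real.rpow_le_rpow_of_nonpos (by positivity) ?_ h).trans
      (le_add_of_nonneg_right (by positivity))
    nlinarith

namespace IsComponent

variable {n : ℕ} {U : Set (Base n)} {χ : Cot n → ℂ} {z : ℂ} {σ τ σ' τ' : Cot n → ℂ}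

open Asymptotics Filter in
-- Along the ray through `ξ` the expansions become finite sums of complex powers of `t`, up to
-- remainders negligible against `t ^ z.re`. Vanishing is only assumed on one fibre, so the lemma
-- yields uniqueness of components and also bounds their support in `x`.
theorem eq_zero_of_forall_eq_zero (hχ : IsCutoff U χ) (h : IsComponent U χ z σ τ) {x : Base n}
    (hx : x ∈ U) (h0 : ∀ ξ, σ (x, ξ) = 0) {ξ : Base n} (hξ : ξ ≠ 0) : τ (x, ξ) = 0 := by
  obtain ⟨r, m, f, s, h1, h2, h3⟩ := h
  obtain ⟨B, hB⟩ := (Set.finite_range fun i => (m i).re - z.re).bddAbove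
  -- This `N` makes every remainder of order less than `z.re`, and every `j` with `m i - j = z` then
  -- satisfies `j ≤ N`.
  obtain ⟨N, hN⟩ := exists_nat_gt B
  have hN' : ∀ i, (m i).re - N - 1 < z.re := fun i => by
    have := hB (Set.mem_range_self i)
    linarith
  have hξ' : 0 < ‖ξ‖ := norm_pos_iff.2 hξ
  let rem : Fin r → ℝ → ℂ := fun i t =>
    f i (x, t • ξ) - ∑ j ∈ Finset.range (N + 1), χ (x, t • ξ) * s i j (x, t • ξ)
  have hrem : ∀ i, rem i =o[atTop] fun t : ℝ => t ^ z.re := fun i => by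
    -- The empty word gives the symbol estimate without derivatives.
    obtain ⟨C, hC⟩ := ((h1 i).2.2 N).2 {x} isCompact_singleton (by simpa using hx) 0 Fin.elim0
    refine IsBigO.trans_isLittleO ?_ (rpow_one_add_mul_isLittleO (hN' i) hξ')
    refine IsBigO.of_bound C ?_
    filter_upwards [eventually_gt_atTop 0] with t ht
    have := hC x rfl (t • ξ)
    rw [norm_smul, Real.norm_of_nonneg ht.le] at this
    rw [Real.norm_of_nonneg (Real.rpow_nonneg (by positivity) _)]
    simpa [rem] using this
  have hsum : (fun t : ℝ => ∑ q ∈ Finset.univ ×ˢ Finset.range (N + 1),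
      s q.1 q.2 (x, ξ) * (t : ℂ) ^ (m q.1 - q.2)) =o[atTop] fun t : ℝ => t ^ z.re := by
    refine ((IsLittleO.sum fun i (_ : i ∈ Finset.univ) => hrem i).neg_left).congr' ?_ .rfl
    filter_upwards [eventually_gt_atTop 0, eventually_ge_atTop ‖ξ‖⁻¹] with t ht ht'
    have hχ1 : χ (x, t • ξ) = 1 := hχ.2.2 x hx _ (by
      rw [norm_smul, Real.norm_of_nonneg ht.le]
      exact (inv_le_iff_one_le_mul₀ hξ').1 ht')
    have hf : ∑ i, f i (x, t • ξ) = 0 := by rw [← h2 _ hx, h0]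
    rw [Finset.sum_product]
    simp only [Finset.sum_apply, rem, hχ1, one_mul, Finset.sum_sub_distrib, hf, zero_sub, neg_neg]
    refine Finset.sum_congr rfl fun i _ => Finset.sum_congr rfl fun j _ => ?_
    rw [((h1 i).2.1 j).2 x hx ξ hξ t ht, mul_comm]
  have hcoeff := sum_coeff_eq_zero_of_isLittleO _ _ _ le_rfl hsum
  rw [h3 _ ⟨hx, hξ⟩, ← hcoeff, Finset.sum_filter, Finset.sum_product]
  refine Finset.sum_congr rfl fun i _ => ?_
  change termOfDegree (m i) (s i) z (x, ξ) = _
  by_cases hz : ∃ j : ℕ, m i - j = z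
  · obtain ⟨j, hj⟩ := hz
    have hjN : j ∈ Finset.range (N + 1) := by
      have := congrArg Complex.re hj
      simp only [Complex.sub_re, Complex.natCast_re] at this
      have h4 := hN' i
      have : (j : ℝ) < N + 1 := by linarith
      exact Finset.mem_range.2 (by exact_mod_cast this)
    rw [termOfDegree_eq _ hj, Finset.sum_eq_single_of_mem j hjN]
    · simp [hj]
    · intro k _ hk
      rw [if_neg]
      intro hk'
      exact hk (by exact_mod_cast sub_right_injective (hk'.trans hj.symm))
  · push Not at hz
    rw [termOfDegree_eq_zero _ hz]
    simp [hz]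

theorem unique (hU : IsOpen U) (hχ : IsCutoff U χ) (h : IsComponent U χ z σ τ)
    (h' : IsComponent U χ z σ τ') : Set.EqOn τ τ' (cotangentMinusZero U) := by
  rintro ⟨x, ξ⟩ ⟨hx, hξ⟩
  have := (h.add (h'.const_mul hU (-1))).eq_zero_of_forall_eq_zero hχ hx (by simp) hξ
  simpa [sub_eq_zero, ← sub_eq_add_neg] using this

/-- This makes the chosen `component` computable from any convenient decomposition. -/
theorem eqOn_component (hU : IsOpen U) (hχ : IsCutoff U χ) (h : IsComponent U χ z σ τ) :
    Set.EqOn (component U χ z σ) τ (cotangentMinusZero U) := by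
  have hex : ∃ τ, IsComponent U χ z σ τ := ⟨τ, h⟩
  rw [component, dif_pos hex]
  exact hex.choose_spec.unique hU hχ h

end IsComponent

/-! ### Integrals of derivatives -/

/-- Integration by parts against the constant 1; only the products have to be integrable. -/
theorem integral_fderiv_apply_eq_zero {E : Type*} [NormedAddCommGroup E] [NormedSpace ℝ E]
    [FiniteDimensional ℝ E] [MeasurableSpace E] [BorelSpace E] (μ : Measure E)
    [μ.IsAddHaarMeasure] {G : E → ℂ} (hG : ContDiff ℝ 1 G) (hc : HasCompactSupport G) (v : E) :
    ∫ x, fderiv ℝ G x v ∂μ = 0 := by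
  have hint : Integrable (fun x => fderiv ℝ G x v) μ :=
    ((hG.continuous_fderiv one_ne_zero).clm_apply continuous_const).integrable_of_hasCompactSupport
      (hc.fderiv_apply ℝ v)
  have := integral_mul_fderiv_eq_neg_fderiv_mul_of_integrable (μ := μ) (f := fun _ : E => (1 : ℂ))
    (g := G) (v := v) (by simp) (by simpa using hint)
    (by simpa using hG.continuous.integrable_of_hasCompactSupport hc)
    (fun x _ => differentiableAt_const _) fun x _ => hG.differentiable one_ne_zero x
  simpa using this

/-! ### Polar coordinates and derivatives on the unit sphere. -/

section Polar

variable {E : Type*} [NormedAddCommGroup E] [InnerProductSpace ℝ E] [FiniteDimensional ℝ E]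
  [Nontrivial E] [MeasurableSpace E] [BorelSpace E] (μ : Measure E) [μ.IsAddHaarMeasure]

open Module in
/-- Polar coordinates for the product of a radial and a homogeneous function. -/
theorem integral_radial_mul_homogeneous {z : ℂ} {g : E → ℂ}
    (hg : ∀ ξ, ξ ≠ 0 → ∀ t : ℝ, 0 < t → g (t • ξ) = (t : ℂ) ^ z * g ξ) (ψ : ℝ → ℂ) :
    ∫ ξ, ψ ‖ξ‖ * g ξ ∂μ = (∫ θ : Metric.sphere (0 : E) 1, g θ ∂μ.toSphere) *
      ∫ r in Set.Ioi (0 : ℝ), ((r : ℂ) ^ (finrank ℝ E - 1)) * (ψ r * (r : ℂ) ^ z) := by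
  -- The origin is a null set; off it, `ξ` is `‖ξ‖` times a unit vector and homogeneity separates
  -- the variables.
  have hsub : ∫ ξ, ψ ‖ξ‖ * g ξ ∂μ =
      ∫ ξ : ({(0)}ᶜ : Set E), ψ ‖ξ.1‖ * g ξ.1 ∂(μ.comap (↑)) := by
    rw [integral_subtype_comap (measurableSet_singleton _).compl fun x => ψ ‖x‖ * g x,
      restrict_compl_singleton]
  have hpolar := μ.measurePreserving_homeomorphUnitSphereProd.integral_comp
    (Homeomorph.measurableEmbedding _)
    (fun q : Metric.sphere (0 : E) 1 × Set.Ioi (0 : ℝ) =>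
      g q.1 * (ψ q.2 * ((q.2 : ℝ) : ℂ) ^ z))
  have hcongr : ∀ ξ : ({(0)}ᶜ : Set E), ψ ‖ξ.1‖ * g ξ.1 =
      g (homeomorphUnitSphereProd E ξ).1 * (ψ (homeomorphUnitSphereProd E ξ).2 *
        (((homeomorphUnitSphereProd E ξ).2 : ℝ) : ℂ) ^ z) := fun ξ => by
    have hξ : ξ.1 ≠ 0 := ξ.2
    have hn : 0 < ‖ξ.1‖ := norm_pos_iff.2 hξ
    simp only [homeomorphUnitSphereProd_apply_snd_coe, homeomorphUnitSphereProd_apply_fst_coe]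
    have h1 := hg (‖ξ.1‖⁻¹ • ξ.1) (smul_ne_zero (inv_ne_zero hn.ne') hξ) ‖ξ.1‖ hn
    rw [smul_inv_smul₀ hn.ne'] at h1
    rw [h1]
    ring
  rw [hsub, integral_congr_ae (.of_forall hcongr), hpolar,
    integral_prod_mul (fun θ : Metric.sphere (0 : E) 1 => g θ)
      (fun r : Set.Ioi (0 : ℝ) => ψ r * ((r : ℝ) : ℂ) ^ z)]
  congr 1
  simp only [Measure.volumeIoiPow, ENNReal.ofReal]
  rw [integral_withDensity_eq_integral_smul
      ((measurable_subtype_coe.pow_const _).real_toNNReal),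
    integral_subtype_comap measurableSet_Ioi
      fun r : ℝ => Real.toNNReal (r ^ (finrank ℝ E - 1)) • (ψ r * (r : ℂ) ^ z)]
  refine setIntegral_congr_fun measurableSet_Ioi fun r hr => ?_
  rw [NNReal.smul_def, Real.coe_toNNReal _ (pow_nonneg (le_of_lt hr) _), Complex.real_smul]
  push_cast
  rfl

omit [FiniteDimensional ℝ E] [Nontrivial E] [MeasurableSpace E] [BorelSpace E] in
-- The product is zero on the unit ball, so neither the norm nor `g` causes trouble at the origin.
theorem contDiff_radial_mul {k : ℕ∞} {ψ : ℝ → ℂ} (hψ : ContDiff ℝ k ψ)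
    (hψ0 : ∀ r < 1, ψ r = 0) {g : E → ℂ} (hg : ContDiffOn ℝ k g {0}ᶜ) :
    ContDiff ℝ k fun ξ => ψ ‖ξ‖ * g ξ := by
  rw [contDiff_iff_contDiffAt]
  intro ξ
  by_cases hξ : ξ = 0
  · subst hξ
    refine (contDiffAt_const (c := (0 : ℂ))).congr_of_eventuallyEq ?_
    filter_upwards [Metric.ball_mem_nhds (0 : E) one_pos] with η hη
    rw [hψ0 _ (by simpa using hη), zero_mul]
  · exact (hψ.contDiffAt.comp ξ (contDiffAt_norm ℝ hξ)).mul
      (hg.contDiffAt (isOpen_compl_singleton.mem_nhds hξ))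

omit [InnerProductSpace ℝ E] [FiniteDimensional ℝ E] [Nontrivial E] [MeasurableSpace E]
  [BorelSpace E] in
theorem hasCompactSupport_radial_mul [ProperSpace E] {ψ : ℝ → ℂ} {b : ℝ}
    (hψ0 : ∀ r, b < r → ψ r = 0) (g : E → ℂ) : HasCompactSupport fun ξ => ψ ‖ξ‖ * g ξ := by
  refine HasCompactSupport.intro (isCompact_closedBall (0 : E) b) fun ξ hξ => ?_
  rw [hψ0 _ (by simpa using hξ), zero_mul]

open Module in
/-- On the unit sphere in dimension `d`, the derivatives of a function which is homogeneous of
degree `1 - d` have integral zero. -/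
theorem integral_toSphere_fderiv_eq_zero {f : E → ℂ} (hf : ContDiffOn ℝ ∞ f {0}ᶜ)
    (hhom : ∀ ξ, ξ ≠ 0 → ∀ t : ℝ, 0 < t → f (t • ξ) = (t : ℂ) ^ (1 - (finrank ℝ E : ℂ)) * f ξ)
    {v : E} (hhom' : ∀ ξ, ξ ≠ 0 → ∀ t : ℝ, 0 < t →
      fderiv ℝ f (t • ξ) v = (t : ℂ) ^ (-(finrank ℝ E : ℂ)) * fderiv ℝ f ξ v) :
    ∫ θ : Metric.sphere (0 : E) 1, fderiv ℝ f θ v ∂μ.toSphere = 0 := by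
  have hopen : IsOpen ({0}ᶜ : Set E) := isOpen_compl_singleton
  let φ : ContDiffBump (2 : ℝ) := ⟨1 / 2, 1, by norm_num, by norm_num⟩
  have hφ : ∀ r, r < 1 ∨ 3 < r → φ r = 0 := fun r hr => φ.zero_of_le_dist (by
    rw [Real.dist_eq]
    change (1 : ℝ) ≤ _
    rcases hr with hr | hr
    · exact le_abs.2 (Or.inr (by linarith))
    · exact le_abs.2 (Or.inl (by linarith)))
  -- With d the dimension, the factor `r` compensates r^(d-1) r^(-d), so that the radial integral
  -- multiplying the sphere integral of the derivative is exactly ∫ φ > 0.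
  let ψ : ℝ → ℂ := fun r => ((r * φ r : ℝ) : ℂ)
  have hψ : ContDiff ℝ ∞ ψ := Complex.ofRealCLM.contDiff.comp (contDiff_id.mul φ.contDiff)
  have hψ0 : ∀ r, r < 1 ∨ 3 < r → ψ r = 0 := fun r hr => by simp [ψ, hφ r hr]
  have hψ'0 : ∀ r, r < 1 ∨ 3 < r → deriv ψ r = 0 := fun r hr => by
    have : IsOpen {r : ℝ | r < 1 ∨ 3 < r} := isOpen_Iio.union isOpen_Ioi
    rw [((show Set.EqOn ψ (fun _ => 0) {r : ℝ | r < 1 ∨ 3 < r} from hψ0).eventuallyEq_of_mem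
      (this.mem_nhds hr)).deriv_eq, deriv_const]
  have hψ' : ContDiff ℝ ∞ (deriv ψ) := hψ.deriv' (n := ∞)
  have hψc : HasCompactSupport ψ := HasCompactSupport.intro (isCompact_Icc (a := 1) (b := 3))
    fun r hr => hψ0 r (by simpa [or_iff_not_imp_left] using hr)
  -- The derivative of the norm is homogeneous of degree 0, so `N * f` has the degree of `f`.
  let N : E → ℂ := fun ξ => ((fderiv ℝ (fun η : E => ‖η‖) ξ v : ℝ) : ℂ)
  have hN : ContDiffOn ℝ 0 N {0}ᶜ := by
    have h1 : ContDiffOn ℝ ∞ (fun η : E => ‖η‖) {0}ᶜ := fun ξ hξ =>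
      (contDiffAt_norm ℝ hξ).contDiffWithinAt
    exact Complex.ofRealCLM.contDiff.comp_contDiffOn
      ((h1.fderiv_of_isOpen hopen (m := 0) (by simp)).clm_apply contDiffOn_const)
  have hf' : ContDiffOn ℝ 0 (fun ξ => fderiv ℝ f ξ v) {0}ᶜ :=
    (hf.fderiv_of_isOpen hopen (m := 0) (by simp)).clm_apply contDiffOn_const
  have hG := contDiff_radial_mul (k := ⊤) hψ (fun r hr => hψ0 r (.inl hr)) hf
  have hzero := integral_fderiv_apply_eq_zero μ (hG.of_le (by exact_mod_cast le_top))
    (hasCompactSupport_radial_mul (fun r hr => hψ0 r (.inr hr)) f) v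
  have hG' : ∀ ξ, fderiv ℝ (fun ξ => ψ ‖ξ‖ * f ξ) ξ v =
      ψ ‖ξ‖ * fderiv ℝ f ξ v + deriv ψ ‖ξ‖ * (N ξ * f ξ) := by
    intro ξ
    by_cases hξ : ξ = 0
    · subst hξ
      have he : (fun ξ => ψ ‖ξ‖ * f ξ) =ᶠ[nhds 0] fun _ => 0 := by
        filter_upwards [Metric.ball_mem_nhds (0 : E) one_pos] with η hη
        rw [hψ0 _ (.inl (by simpa using hη)), zero_mul]
      rw [he.fderiv_eq, norm_zero, hψ0 0 (.inl one_pos), hψ'0 0 (.inl one_pos)]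
      simp
    · have h1 : HasFDerivAt (fun η : E => ‖η‖) _ ξ :=
        ((contDiffAt_norm ℝ (n := 1) hξ).differentiableAt one_ne_zero).hasFDerivAt
      have h2 : HasDerivAt ψ (deriv ψ ‖ξ‖) ‖ξ‖ :=
        (hψ.differentiable (by simp) _).hasDerivAt
      have h3 : HasFDerivAt f _ ξ :=
        ((hf.contDiffAt (hopen.mem_nhds hξ)).differentiableAt (by simp)).hasFDerivAt
      have h4 := ((h2.hasFDerivAt.comp ξ h1).mul h3).fderiv
      rw [show (fun ξ => ψ ‖ξ‖ * f ξ) = (ψ ∘ fun η : E => ‖η‖) * f from rfl, h4]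
      change _ = ψ ‖ξ‖ * fderiv ℝ f ξ v +
        deriv ψ ‖ξ‖ * (((fderiv ℝ norm ξ v : ℝ) : ℂ) * f ξ)
      simp
      ring
  have hi1 : Integrable (fun ξ => ψ ‖ξ‖ * fderiv ℝ f ξ v) μ :=
    (contDiff_radial_mul (k := 0) (hψ.of_le (by simp)) (fun r hr => hψ0 r (.inl hr))
      hf').continuous.integrable_of_hasCompactSupport
        (hasCompactSupport_radial_mul (fun r hr => hψ0 r (.inr hr)) _)
  have hi2 : Integrable (fun ξ => deriv ψ ‖ξ‖ * (N ξ * f ξ)) μ :=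
    (contDiff_radial_mul (k := 0) (hψ'.of_le (by simp)) (fun r hr => hψ'0 r (.inl hr))
      (hN.mul (hf.of_le (by simp)))).continuous.integrable_of_hasCompactSupport
        (hasCompactSupport_radial_mul (fun r hr => hψ'0 r (.inr hr)) _)
  have hNhom : ∀ ξ, ξ ≠ 0 → ∀ t : ℝ, 0 < t →
      N (t • ξ) * f (t • ξ) = (t : ℂ) ^ (1 - (finrank ℝ E : ℂ)) * (N ξ * f ξ) := by
    intro ξ hξ t ht
    simp only [N, fderiv_norm_smul_pos ht, hhom ξ hξ t ht]
    ring
  simp only [hG'] at hzero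
  rw [integral_add hi1 hi2, integral_radial_mul_homogeneous μ hhom',
    integral_radial_mul_homogeneous μ hNhom] at hzero
  have hd : 1 ≤ finrank ℝ E := finrank_pos
  have hpow : ∀ r ∈ Set.Ioi (0 : ℝ), ((r : ℂ) ^ (finrank ℝ E - 1)) *
      (r : ℂ) ^ (1 - (finrank ℝ E : ℂ)) = 1 := fun r hr => by
    have hr0 : (r : ℂ) ≠ 0 := by exact_mod_cast (ne_of_gt hr)
    rw [← Complex.cpow_natCast, ← Complex.cpow_add _ _ hr0, Nat.cast_sub hd]
    simp
  have hsupp : ∀ {h : ℝ → ℂ}, (∀ r, r < 1 ∨ 3 < r → h r = 0) →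
      ∫ r in Set.Ioi (0 : ℝ), h r = ∫ r, h r := fun h0 =>
    setIntegral_eq_integral_of_forall_compl_eq_zero fun r hr =>
      h0 r (.inl ((not_lt.1 hr).trans_lt one_pos))
  -- Here the powers of `r` cancel, leaving the integral of the derivative of a compactly supported
  -- function.
  have hI2 : ∫ r in Set.Ioi (0 : ℝ), ((r : ℂ) ^ (finrank ℝ E - 1)) *
      (deriv ψ r * (r : ℂ) ^ (1 - (finrank ℝ E : ℂ))) = 0 := by
    rw [setIntegral_congr_fun measurableSet_Ioi (g := deriv ψ), hsupp hψ'0]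
    · exact integral_fderiv_apply_eq_zero volume (hψ.of_le (by simp)) hψc 1
    · intro r hr
      simp only
      rw [mul_left_comm, hpow r hr, mul_one]
  have hI1 : ∫ r in Set.Ioi (0 : ℝ), ((r : ℂ) ^ (finrank ℝ E - 1)) *
      (ψ r * (r : ℂ) ^ (-(finrank ℝ E : ℂ))) = ((∫ r, φ r : ℝ) : ℂ) := by
    rw [setIntegral_congr_fun measurableSet_Ioi (g := fun r => ((φ r : ℝ) : ℂ)),
      hsupp fun r hr => by simp [hφ r hr]]
    · exact integral_ofReal
    · intro r hr
      have hr0 : (r : ℂ) ≠ 0 := by exact_mod_cast (ne_of_gt hr)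
      have h1 : (r : ℂ) ^ (1 - (finrank ℝ E : ℂ)) = r * (r : ℂ) ^ (-(finrank ℝ E : ℂ)) := by
        rw [sub_eq_add_neg, Complex.cpow_add _ _ hr0, Complex.cpow_one]
      have h2 := hpow r hr
      rw [h1] at h2
      simp only [ψ, Complex.ofReal_mul]
      linear_combination (φ r : ℂ) * h2
  rw [hI1, hI2, mul_zero, add_zero] at hzero
  exact (mul_eq_zero.1 hzero).resolve_right (by exact_mod_cast φ.integral_pos.ne')

end Polar

/-! ### Integrals over the cosphere bundle. -/

variable {n : ℕ} {U : Set (Base n)}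

theorem fderiv_comp_prodMk_left {τ : Cot n → ℂ} {x ξ : Base n}
    (h : DifferentiableAt ℝ τ (x, ξ)) (i : Fin n) :
    fderiv ℝ (fun y => τ (y, ξ)) x (EuclideanSpace.single i 1) = pderiv (Sum.inl i) τ (x, ξ) := by
  have := (HasFDerivAt.comp (f := fun y => (y, ξ)) x h.hasFDerivAt
    (hasFDerivAt_prodMk_left x ξ)).fderiv
  rw [show (fun y => τ (y, ξ)) = τ ∘ fun y => (y, ξ) from rfl, this]
  rfl

theorem fderiv_comp_prodMk_right {τ : Cot n → ℂ} {x ξ : Base n}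
    (h : DifferentiableAt ℝ τ (x, ξ)) (j : Fin n) :
    fderiv ℝ (fun y => τ (x, y)) ξ (EuclideanSpace.single j 1) = pderiv (Sum.inr j) τ (x, ξ) := by
  have := (HasFDerivAt.comp (f := fun y => (x, y)) ξ h.hasFDerivAt
    (hasFDerivAt_prodMk_right x ξ)).fderiv
  rw [show (fun y => τ (x, y)) = τ ∘ fun y => (x, y) from rfl, this]
  rfl

/-- Nothing is known about `τ` over the complement of `U`, so it is replaced by its extension by
zero, which is C¹ because `K` is a compact subset of `U`. -/
theorem setIntegral_pderiv_inl_eq_zero (hU : IsOpen U) {τ : Cot n → ℂ}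
    (hτ : ContDiffOn ℝ ∞ τ (cotangentMinusZero U)) {K : Set (Base n)} (hK : IsCompact K)
    (hKU : K ⊆ U) {ξ : Base n} (hξ : ξ ≠ 0) (h0 : ∀ x ∈ U, x ∉ K → τ (x, ξ) = 0) (i : Fin n) :
    ∫ x in U, pderiv (Sum.inl i) τ (x, ξ) = 0 := by
  have hV := isOpen_cotangentMinusZero hU
  let u : Base n → ℂ := U.indicator fun x => τ (x, ξ)
  have hu0 : ∀ x, x ∉ K → u x = 0 := fun x hx => by
    by_cases hxU : x ∈ U
    · simp [u, hxU, h0 x hxU hx]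
    · simp [u, hxU]
  have heU : ∀ x ∈ U, u =ᶠ[nhds x] fun x => τ (x, ξ) := fun x hx =>
    Filter.eventually_of_mem (hU.mem_nhds hx) fun y hy => Set.indicator_of_mem hy _
  have heK : ∀ x, x ∉ K → u =ᶠ[nhds x] fun _ => 0 := fun x hx =>
    Filter.eventually_of_mem (hK.isClosed.isOpen_compl.mem_nhds hx) fun y hy => hu0 y hy
  have hsm : ContDiff ℝ 1 u := by
    rw [contDiff_iff_contDiffAt]
    intro x
    by_cases hx : x ∈ U
    · refine ContDiffAt.congr_of_eventuallyEq ?_ (heU x hx)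
      have h1 : ContDiffAt ℝ 1 τ (x, ξ) :=
        (hτ.contDiffAt (hV.mem_nhds ⟨hx, hξ⟩)).of_le (by exact_mod_cast le_top)
      exact h1.comp x (contDiffAt_id.prodMk contDiffAt_const)
    · exact contDiffAt_const.congr_of_eventuallyEq (heK x fun h => hx (hKU h))
  refine Eq.trans ?_ (integral_fderiv_apply_eq_zero volume hsm (HasCompactSupport.intro hK hu0)
    (EuclideanSpace.single i 1))
  have hset := setIntegral_eq_integral_of_forall_compl_eq_zero (μ := volume) (s := U)
    (f := fun x => fderiv ℝ u x (EuclideanSpace.single i 1)) fun x hx => by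
      rw [(heK x fun h => hx (hKU h)).fderiv_eq]
      simp
  rw [← hset]
  refine setIntegral_congr_fun hU.measurableSet fun x hx => ?_
  rw [(heU x hx).fderiv_eq, fderiv_comp_prodMk_left
    (differentiableAt_of_contDiffOn hV hτ ⟨hx, hξ⟩)]

theorem sphere_ne_zero (θ : Metric.sphere (0 : Base n) 1) : (θ : Base n) ≠ 0 := fun h => by
  have := norm_eq_of_mem_sphere θ
  simp [h] at this

/-- A continuous function on `T^*U - {0}` which vanishes outside a compact set of base points is
integrable on the cosphere bundle. -/
theorem integrable_cosphere (hU : IsOpen U) {τ : Cot n → ℂ}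
    (hτ : ContinuousOn τ (cotangentMinusZero U)) {K : Set (Base n)} (hK : IsCompact K)
    (hKU : K ⊆ U) (h0 : ∀ x ∈ U, x ∉ K → ∀ ξ, ξ ≠ 0 → τ (x, ξ) = 0) :
    Integrable (fun q : Base n × Metric.sphere (0 : Base n) 1 => τ (q.1, (q.2 : Base n)))
      (((volume : Measure (Base n)).restrict U).prod (volume : Measure (Base n)).toSphere) := by
  have hmeas : ((volume : Measure (Base n)).restrict U).prod (volume : Measure (Base n)).toSphere =
      ((volume : Measure (Base n)).prod (volume : Measure (Base n)).toSphere).restrict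
        (U ×ˢ Set.univ) := by
    rw [← Measure.prod_restrict, Measure.restrict_univ]
  rw [hmeas]
  have hcont : ContinuousOn
      (fun q : Base n × Metric.sphere (0 : Base n) 1 => τ (q.1, (q.2 : Base n)))
      (K ×ˢ Set.univ) :=
    hτ.comp (by fun_prop) fun q hq => ⟨hKU hq.1, sphere_ne_zero q.2⟩
  have hint := hcont.integrableOn_compact (hK.prod isCompact_univ)
    (μ := (volume : Measure (Base n)).prod (volume : Measure (Base n)).toSphere)
  exact hint.of_forall_sdiff_eq_zero (hU.measurableSet.prod .univ) fun q hq =>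
    h0 q.1 hq.1.1 (fun h => hq.2 ⟨h, trivial⟩) _ (sphere_ne_zero q.2)

theorem integral_cosphere_pderiv_inl_eq_zero (hU : IsOpen U) {τ : Cot n → ℂ}
    (hτ : ContDiffOn ℝ ∞ τ (cotangentMinusZero U)) {K : Set (Base n)} (hK : IsCompact K)
    (hKU : K ⊆ U) (h0 : ∀ x ∈ U, x ∉ K → ∀ ξ, ξ ≠ 0 → τ (x, ξ) = 0) (i : Fin n)
    (hint : Integrable (fun q : Base n × Metric.sphere (0 : Base n) 1 =>
      pderiv (Sum.inl i) τ (q.1, (q.2 : Base n)))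
      (((volume : Measure (Base n)).restrict U).prod (volume : Measure (Base n)).toSphere)) :
    ∫ x in U, ∫ θ : Metric.sphere (0 : Base n) 1, pderiv (Sum.inl i) τ (x, (θ : Base n))
      ∂((volume : Measure (Base n)).toSphere) = 0 := by
  rw [integral_integral_swap hint]
  refine integral_eq_zero_of_ae (.of_forall fun θ => ?_)
  exact setIntegral_pderiv_inl_eq_zero hU hτ hK hKU (sphere_ne_zero θ)
    (fun x hx hxK => h0 x hx hxK _ (sphere_ne_zero θ)) i

theorem integral_sphere_pderiv_inr_eq_zero (hU : IsOpen U) {τ : Cot n → ℂ}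
    (hτ : IsPosHomogeneous U (-(n : ℂ) + 1) τ) {x : Base n} (hx : x ∈ U) (j : Fin n) :
    ∫ θ : Metric.sphere (0 : Base n) 1, pderiv (Sum.inr j) τ (x, (θ : Base n))
      ∂((volume : Measure (Base n)).toSphere) = 0 := by
  have hV := isOpen_cotangentMinusZero hU
  -- The index `j` excludes `n = 0`; polar coordinates need a nontrivial space.
  have : NeZero n := ⟨fun h => (h ▸ j).elim0⟩
  have hd : ∀ ξ : Base n, ξ ≠ 0 →
      fderiv ℝ (fun y => τ (x, y)) ξ (EuclideanSpace.single j 1) = pderiv (Sum.inr j) τ (x, ξ) :=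
    fun ξ hξ => fderiv_comp_prodMk_right (differentiableAt_of_contDiffOn hV hτ.1 ⟨hx, hξ⟩) j
  have hτ' := hτ.pderiv hU (Sum.inr j)
  simp only [fiberWeight, Sum.isRight_inr, if_true, Nat.cast_one, add_sub_cancel_right] at hτ'
  rw [← integral_toSphere_fderiv_eq_zero (E := Base n) volume (f := fun y => τ (x, y))
    (v := EuclideanSpace.single j 1)]
  · exact integral_congr_ae (.of_forall fun θ => (hd θ (sphere_ne_zero θ)).symm)
  · exact hτ.1.comp (contDiff_const.prodMk contDiff_id).contDiffOn fun ξ hξ => ⟨hx, hξ⟩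
  · intro ξ hξ t ht
    rw [hτ.2 x hx ξ hξ t ht, finrank_euclideanSpace_fin, neg_add_eq_sub]
  · intro ξ hξ t ht
    rw [hd _ hξ, hd _ (smul_ne_zero ht.ne' hξ), hτ'.2 x hx ξ hξ t ht, finrank_euclideanSpace_fin]

/-! ### Coordinates of symbol valued forms -/

variable {n k : ℕ} {U : Set (Base n)} {χ : Cot n → ℂ}

/-- The coefficient of a form on an arbitrary tuple of coordinate vectors. -/
def coordCoeff (η : KForm n k) (c : Fin k → Fin n ⊕ Fin n) : Cot n → ℂ :=
  fun p => η p fun a => coordVec (c a)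

/-- The increasing enumeration of `I` followed by that of `J`. -/
def stdTuple (I J : Finset (Fin n)) (h : k = I.card + J.card) : Fin k → Fin n ⊕ Fin n :=
  fun a => Fin.append (fun b => Sum.inl (I.orderEmbOfFin rfl b))
    (fun b => Sum.inr (J.orderEmbOfFin rfl b)) (Fin.cast h a)

theorem coeff_eq_coordCoeff (η : KForm n k) (I J : Finset (Fin n)) (h : k = I.card + J.card) :
    coeff η I J h = coordCoeff η (stdTuple I J h) := by
  ext p
  unfold coeff coordCoeff stdTuple
  congr 1
  ext1 a
  generalize Fin.cast h a = b
  refine Fin.addCases (fun b => ?_) (fun b => ?_) b <;> simp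

theorem sum_fiberWeight_stdTuple (I J : Finset (Fin n)) (h : k = I.card + J.card) :
    ∑ a, fiberWeight (stdTuple I J h a) = J.card := by
  subst h
  simp [stdTuple, Fin.sum_univ_add, fiberWeight]

theorem inl_mem_range_stdTuple {I : Finset (Fin n)} (J : Finset (Fin n))
    (h : k = I.card + J.card) {i : Fin n} (hi : i ∈ I) :
    Sum.inl i ∈ Set.range (stdTuple I J h) := by
  have : i ∈ Set.range (I.orderEmbOfFin rfl) := by rwa [Finset.range_orderEmbOfFin]
  obtain ⟨b, rfl⟩ := this
  exact ⟨Fin.cast h.symm (Fin.castAdd _ b), by simp [stdTuple]⟩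

theorem inr_mem_range_stdTuple (I : Finset (Fin n)) {J : Finset (Fin n)}
    (h : k = I.card + J.card) {j : Fin n} (hj : j ∈ J) :
    Sum.inr j ∈ Set.range (stdTuple I J h) := by
  have : j ∈ Set.range (J.orderEmbOfFin rfl) := by rwa [Finset.range_orderEmbOfFin]
  obtain ⟨b, rfl⟩ := this
  exact ⟨Fin.cast h.symm (Fin.natAdd _ b), by simp [stdTuple]⟩

/-- Sorting a tuple without repetitions: `I` and `J` are its base and fibre entries. -/
theorem exists_perm_eq_stdTuple {c : Fin k → Fin n ⊕ Fin n} (hc : Function.Injective c) :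
    ∃ (I J : Finset (Fin n)) (h : k = I.card + J.card) (e : Equiv.Perm (Fin k)),
      c = stdTuple I J h ∘ e := by
  classical
  let S : Finset (Fin n ⊕ Fin n) := Finset.univ.image c
  have h : k = S.toLeft.card + S.toRight.card := by
    rw [Finset.card_toLeft_add_card_toRight, Finset.card_image_of_injective _ hc,
      Finset.card_univ, Fintype.card_fin]
  have hmem : ∀ a, c a ∈ Set.range (stdTuple S.toLeft S.toRight h) := fun a => by
    have ha : c a ∈ S := Finset.mem_image_of_mem c (Finset.mem_univ a)
    cases hca : c a with
    | inl i => exact inl_mem_range_stdTuple _ h (Finset.mem_toLeft.2 (hca ▸ ha))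
    | inr j => exact inr_mem_range_stdTuple _ h (Finset.mem_toRight.2 (hca ▸ ha))
  choose e he using hmem
  have hinj : Function.Injective e := fun a b hab => hc (by rw [← he a, ← he b, hab])
  exact ⟨_, _, h, Equiv.ofBijective e (Finite.injective_iff_bijective.1 hinj),
    funext fun a => (he a).symm⟩

/-- The definition constrains only increasing tuples. Any other tuple gives zero if an entry
repeats, and otherwise a standard coefficient up to sign. Allowing all tuples avoids identifying `I`
and `J` after an entry is deleted. -/
theorem IsClassicalForm.coordCoeff (hU : IsOpen U) {m : ℂ} {η : KForm n k}
    (hη : IsClassicalForm U χ m η) (c : Fin k → Fin n ⊕ Fin n) :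
    IsClassical U χ (m - ((∑ a, fiberWeight (c a) : ℕ) : ℂ)) (coordCoeff η c) := by
  by_cases hc : Function.Injective c
  · obtain ⟨I, J, h, e, rfl⟩ := exists_perm_eq_stdTuple hc
    have hsum : ∑ a, fiberWeight ((stdTuple I J h ∘ e) a) = J.card :=
      (Equiv.sum_comp e fun a => fiberWeight (stdTuple I J h a)).trans (sum_fiberWeight_stdTuple I J h)
    rw [hsum]
    have h1 := hη I J h
    rw [coeff_eq_coordCoeff] at h1
    refine (h1.const_mul hU ((Equiv.Perm.sign e : ℤ) : ℂ)).congr hU fun p _ => ?_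
    have h2 := (η p).toAlternatingMap.map_perm (fun a => coordVec (stdTuple I J h a)) e
    refine Eq.trans ?_ h2.symm
    rw [Units.smul_def, zsmul_eq_mul]
    rfl
  · refine IsClassical.of_eqOn_zero hU (fun p _ => ?_) _
    exact (η p).map_eq_zero_of_not_injective _ fun h => hc fun a b hab => h (by simp only [hab])

theorem isClassicalForm_of_eqOn_zero (hU : IsOpen U) {η : KForm n k}
    (h0 : ∀ p ∈ cotangent U, η p = 0) (m : ℂ) : IsClassicalForm U χ m η := fun I J h =>
  .of_eqOn_zero hU (fun p hp => by simp [coeff, h0 p hp]) _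

/-- The coordinate basis of `ℝⁿ × ℝⁿ`. -/
def coordBasis (n : ℕ) : Module.Basis (Fin n ⊕ Fin n) ℝ (Cot n) :=
  (EuclideanSpace.basisFun (Fin n) ℝ).toBasis.prod (EuclideanSpace.basisFun (Fin n) ℝ).toBasis

theorem coordBasis_apply (c : Fin n ⊕ Fin n) : coordBasis n c = coordVec c := by
  cases c <;> simp [coordBasis, Module.Basis.prod_apply, coordVec]

/-- A form is smooth when its coefficients are. -/
theorem contDiffOn_of_coordCoeff {V : Set (Cot n)} {η : KForm n k}
    (h : ∀ c, ContDiffOn ℝ ∞ (coordCoeff η c) V) : ContDiffOn ℝ ∞ η V := by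
  -- Evaluation on coordinate tuples is injective; a linear left inverse, continuous in finite
  -- dimension, recovers the form from its coefficients.
  let ev : (Cot n [⋀^Fin k]→L[ℝ] ℂ) →ₗ[ℝ] ((Fin k → Fin n ⊕ Fin n) → ℂ) :=
    { toFun := fun ζ c => ζ fun a => coordVec (c a)
      map_add' := fun _ _ => rfl
      map_smul' := fun _ _ => rfl }
  have hinj : LinearMap.ker ev = ⊥ := by
    rw [LinearMap.ker_eq_bot]
    intro ζ₁ ζ₂ h12
    refine ContinuousAlternatingMap.toAlternatingMap_injective
      ((coordBasis n).ext_alternating fun c _ => ?_)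
    simp only [coordBasis_apply]
    exact congrFun h12 c
  obtain ⟨L, hL⟩ := ev.exists_leftInverse_of_injective hinj
  have hη : η = fun p => LinearMap.toContinuousLinearMap L fun c => coordCoeff η c p := by
    ext1 p
    exact (LinearMap.congr_fun hL (η p)).symm
  rw [hη]
  exact (LinearMap.toContinuousLinearMap L).contDiff.comp_contDiffOn (contDiffOn_pi.2 h)

theorem IsClassicalForm.contDiffOn (hU : IsOpen U) {m : ℂ} {η : KForm n k}
    (hη : IsClassicalForm U χ m η) : ContDiffOn ℝ ∞ η (cotangent U) :=
  contDiffOn_of_coordCoeff fun c =>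
    let ⟨_, hs⟩ := hη.coordCoeff hU c
    hs.1.1

theorem coordCoeff_extDeriv {η : KForm n k} {p : Cot n} (h : DifferentiableAt ℝ η p)
    (c : Fin (k + 1) → Fin n ⊕ Fin n) :
    coordCoeff (extDeriv η) c p =
      ∑ a : Fin (k + 1), (-1) ^ (a : ℕ) * pderiv (c a) (coordCoeff η (a.removeNth c)) p := by
  unfold coordCoeff
  rw [extDeriv_apply h]
  refine Finset.sum_congr rfl fun a _ => ?_
  rw [← Int.cast_smul_eq_zsmul ℂ, smul_eq_mul]
  push_cast
  rfl

theorem IsClassicalForm.extDeriv (hU : IsOpen U) (hχ : IsCutoff U χ) {m : ℂ} {η : KForm n k}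
    (hη : IsClassicalForm U χ m η) : IsClassicalForm U χ m (extDeriv η) := fun I J h => by
  rw [coeff_eq_coordCoeff, ← sum_fiberWeight_stdTuple I J h]
  set c := stdTuple I J h
  refine (IsClassical.sum hU Finset.univ (f := fun (a : Fin (k + 1)) p => (-1 : ℂ) ^ (a : ℕ) *
    pderiv (c a) (Wodzicki.coordCoeff η (a.removeNth c)) p) fun a _ => ?_).congr hU
    fun p hp => (coordCoeff_extDeriv
      (differentiableAt_of_contDiffOn (isOpen_cotangent hU) (hη.contDiffOn hU) hp) c).symm
  refine IsClassical.const_mul hU ?_ _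
  convert (hη.coordCoeff hU (a.removeNth c)).pderiv hU hχ (c a) using 1
  -- The weight of `c a`, lost by differentiation, completes the weight of the remaining entries to
  -- that of `c`, so the order `m` of the form is unchanged.
  rw [Fin.sum_univ_succAbove _ a]
  simp only [Fin.removeNth]
  push_cast
  ring

/-! ### Linear spans of classical forms. -/

theorem contDiffOn_of_mem_classicalKForms (hU : IsOpen U) {η : KForm n k}
    (hη : η ∈ classicalKForms U χ k) : ContDiffOn ℝ ∞ η (cotangent U) := by
  induction hη using Submodule.span_induction with
  | mem η h =>
    obtain ⟨m, hm⟩ := Set.mem_iUnion.1 h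
    exact IsClassicalForm.contDiffOn hU hm
  | zero => exact contDiffOn_const
  | add η ζ _ _ h1 h2 => exact h1.add h2
  | smul a η _ h => exact contDiffOn_const.smul h

/-- Forms are total functions that are smooth only on `T^*U`, so linearity of `extDeriv` is
available only there. The discrepancy vanishes on `T^*U` and is itself classical. -/
theorem mem_classicalKForms_of_eqOn (hU : IsOpen U) {η ζ : KForm n k}
    (hη : η ∈ classicalKForms U χ k) (h : Set.EqOn η ζ (cotangent U)) :
    ζ ∈ classicalKForms U χ k := by
  have h0 : ζ - η ∈ classicalKForms U χ k := Submodule.subset_span (Set.mem_iUnion.2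
    ⟨0, isClassicalForm_of_eqOn_zero hU (fun p hp => by simp [h hp]) 0⟩)
  simpa using add_mem hη h0

theorem extDeriv_mem_classicalKForms (hU : IsOpen U) (hχ : IsCutoff U χ) {η : KForm n k}
    (hη : η ∈ classicalKForms U χ k) : extDeriv η ∈ classicalKForms U χ (k + 1) := by
  have hT := isOpen_cotangent hU
  induction hη using Submodule.span_induction with
  | mem η h =>
    obtain ⟨m, hm⟩ := Set.mem_iUnion.1 h
    exact Submodule.subset_span (Set.mem_iUnion.2 ⟨m, IsClassicalForm.extDeriv hU hχ hm⟩)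
  | zero =>
    convert zero_mem (classicalKForms U χ (k + 1)) using 1
    ext1 p
    simpa using extDeriv_smul (x := p) (0 : ℝ) (0 : KForm n k)
  | add η ζ hη hζ h1 h2 =>
    refine mem_classicalKForms_of_eqOn hU (add_mem h1 h2) fun p hp => ?_
    exact (extDeriv_add
      (differentiableAt_of_contDiffOn hT (contDiffOn_of_mem_classicalKForms hU hη) hp)
      (differentiableAt_of_contDiffOn hT (contDiffOn_of_mem_classicalKForms hU hζ) hp)).symm
  | smul a η hη h =>
    refine mem_classicalKForms_of_eqOn hU (Submodule.smul_mem _ a h) fun p hp => ?_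
    have hd := differentiableAt_of_contDiffOn hT (contDiffOn_of_mem_classicalKForms hU hη) hp
    have hd' := differentiableAt_of_contDiffOn hT (contDiffOn_of_mem_classicalKForms hU
      (Submodule.smul_mem _ a hη)) hp
    -- The scalar is complex while differentiation is over ℝ, so the identity is verified on each
    -- tuple of vectors.
    ext v
    rw [Pi.smul_apply, ContinuousAlternatingMap.smul_apply, extDeriv_apply hd, extDeriv_apply hd',
      Finset.smul_sum]
    refine Finset.sum_congr rfl fun i _ => ?_
    have hi : DifferentiableAt ℝ (fun q => η q (i.removeNth v)) p :=
      hd.continuousAlternatingMap_apply fun _ => differentiableAt_const _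
    rw [smul_comm, show (fun q => (a • η) q (i.removeNth v)) =
      a • fun q => η q (i.removeNth v) from rfl, fderiv_const_smul hi]
    rfl

theorem exists_isComponent_coordCoeff (hU : IsOpen U) {η : KForm n k}
    (hη : η ∈ classicalKForms U χ k) (c : Fin k → Fin n ⊕ Fin n) (z : ℂ) :
    ∃ τ, IsComponent U χ z (coordCoeff η c) τ := by
  induction hη using Submodule.span_induction with
  | mem η h =>
    obtain ⟨m, hm⟩ := Set.mem_iUnion.1 h
    obtain ⟨s, hs⟩ := IsClassicalForm.coordCoeff hU hm c
    exact ⟨_, IsComponent.of_fintype (ι := Unit) (fun _ => hs) (by simp) fun p _ => rfl⟩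
  | zero => exact ⟨_, IsComponent.zero⟩
  | add η ζ _ _ h1 h2 =>
    obtain ⟨τ, hτ⟩ := h1
    obtain ⟨τ', hτ'⟩ := h2
    exact ⟨_, hτ.add hτ'⟩
  | smul a η _ h =>
    obtain ⟨τ, hτ⟩ := h
    exact ⟨_, hτ.const_mul hU a⟩

theorem extD_mem_classicalForms (hU : IsOpen U) (hχ : IsCutoff U χ) {β : Form n}
    (hβ : β ∈ classicalForms U χ) : extD β ∈ classicalForms U χ := by
  rw [classicalForms, Submodule.mem_pi] at hβ ⊢
  rintro (_ | k) -
  · exact zero_mem _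
  · exact extDeriv_mem_classicalKForms hU hχ (hβ k trivial)

theorem CompactlySupported.extD (hU : IsOpen U) {β : Form n} (h : CompactlySupported U β) :
    CompactlySupported U (extD β) := by
  obtain ⟨K, hK, hKU, h0⟩ := h
  refine ⟨K, hK, hKU, ?_⟩
  rintro p hp hpK (_ | k)
  · rfl
  · have hopen : IsOpen {q : Cot n | q.1 ∈ U ∧ q.1 ∉ K} :=
      (hU.preimage continuous_fst).inter (hK.isClosed.isOpen_compl.preimage continuous_fst)
    have he : β k =ᶠ[nhds p] fun _ => 0 :=
      Filter.eventually_of_mem (hopen.mem_nhds ⟨hp, hpK⟩) fun q hq => h0 q hq.1 hq.2 k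
    change extDeriv (β k) p = 0
    rw [extDeriv, he.fderiv_eq]
    ext v
    simp [ContinuousAlternatingMap.alternatizeUncurryFin_apply]

/-! ### The residue of an exact form -/

/-- The integral over the cosphere bundle of a derivative of a component of a compactly supported
symbol, taken in the degree for which the result has degree `-n`. -/
theorem integral_cosphere_pderiv_component (hU : IsOpen U) (hχ : IsCutoff U χ)
    {c : Fin n ⊕ Fin n} {σ τ : Cot n → ℂ} (h : IsComponent U χ (-(n : ℂ) + fiberWeight c) σ τ)
    {K : Set (Base n)} (hK : IsCompact K) (hKU : K ⊆ U)
    (h0 : ∀ p ∈ cotangent U, p.1 ∉ K → σ p = 0) :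
    Integrable (fun q : Base n × Metric.sphere (0 : Base n) 1 => pderiv c τ (q.1, (q.2 : Base n)))
      (((volume : Measure (Base n)).restrict U).prod (volume : Measure (Base n)).toSphere) ∧
    ∫ q : Base n × Metric.sphere (0 : Base n) 1, pderiv c τ (q.1, (q.2 : Base n))
      ∂((volume : Measure (Base n)).restrict U).prod (volume : Measure (Base n)).toSphere = 0 := by
  have hV := isOpen_cotangentMinusZero hU
  have hτ := h.isPosHomogeneous
  have hτ0 : ∀ x ∈ U, x ∉ K → ∀ ξ, ξ ≠ 0 → τ (x, ξ) = 0 := fun x hx hxK ξ hξ =>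
    h.eq_zero_of_forall_eq_zero hχ hx (fun η => h0 (x, η) hx hxK) hξ
  have hopen : IsOpen {p : Cot n | p ∈ cotangentMinusZero U ∧ p.1 ∉ K} :=
    hV.inter (hK.isClosed.isOpen_compl.preimage continuous_fst)
  have hint := integrable_cosphere hU (contDiffOn_pderiv hV hτ.1 c).continuousOn hK hKU
    fun x hx hxK ξ hξ => pderiv_of_eqOn_zero hopen
      (fun p hp => hτ0 p.1 hp.1.1 hp.2 p.2 hp.1.2) c (x, ξ) ⟨⟨hx, hξ⟩, hxK⟩
  refine ⟨hint, ?_⟩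
  rw [integral_prod _ hint]
  -- Base derivatives need only the compact support; fibre derivatives need only the degree 1 - n.
  cases c with
  | inl i => exact integral_cosphere_pderiv_inl_eq_zero hU hτ.1 hK hKU hτ0 i hint
  | inr j =>
    refine setIntegral_eq_zero_of_forall_eq_zero fun x hx => ?_
    refine integral_sphere_pderiv_inr_eq_zero hU ?_ hx j
    simpa [fiberWeight] using hτ

/-- A variable `k` permits the case split in the definition of `extD`; the case `k = 0` covers `n =
0`. -/
theorem exists_isComponent_coeff_extD (hU : IsOpen U) (hχ : IsCutoff U χ) {β : Form n}
    (hβ : β ∈ classicalForms U χ) (hsupp : CompactlySupported U β) (k : ℕ) (I J : Finset (Fin n))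
    (h : k = I.card + J.card) :
    ∃ τ, IsComponent U χ (-(n : ℂ)) (coeff (extD β k) I J h) τ ∧
      Integrable (fun q : Base n × Metric.sphere (0 : Base n) 1 => τ (q.1, (q.2 : Base n)))
        (((volume : Measure (Base n)).restrict U).prod (volume : Measure (Base n)).toSphere) ∧
      ∫ q : Base n × Metric.sphere (0 : Base n) 1, τ (q.1, (q.2 : Base n))
        ∂((volume : Measure (Base n)).restrict U).prod
          (volume : Measure (Base n)).toSphere = 0 := by
  cases k with
  | zero => exact ⟨fun _ => 0, IsComponent.zero, by simp, by simp⟩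
  | succ k =>
    obtain ⟨K, hK, hKU, h0⟩ := hsupp
    have hmem : β k ∈ classicalKForms U χ k := Submodule.mem_pi.1 hβ k trivial
    set c := stdTuple I J h with hc
    -- The degree is raised by `fiberWeight (c a)` so that the derivative in direction `c a` has
    -- degree -n.
    choose τ hτ using fun a : Fin (k + 1) => exists_isComponent_coordCoeff hU hmem
      (a.removeNth c) (-(n : ℂ) + fiberWeight (c a))
    have hτ' := fun a => integral_cosphere_pderiv_component hU hχ (hτ a) hK hKU
      fun p hp hpK => by simp [coordCoeff, h0 p hp hpK k]
    refine ⟨fun p => ∑ a : Fin (k + 1), (-1) ^ (a : ℕ) * pderiv (c a) (τ a) p, ?_, ?_, ?_⟩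
    · rw [coeff_eq_coordCoeff, ← hc]
      refine (IsComponent.sum Finset.univ (f := fun (a : Fin (k + 1)) p => (-1 : ℂ) ^ (a : ℕ) *
        pderiv (c a) (coordCoeff (β k) (a.removeNth c)) p) fun a _ =>
          IsComponent.const_mul hU ?_ _).congr_left fun p hp => (coordCoeff_extDeriv
            (differentiableAt_of_contDiffOn (isOpen_cotangent hU)
              (contDiffOn_of_mem_classicalKForms hU hmem) hp) c).symm
      simpa using (hτ a).pderiv hU hχ (c a)
    · exact integrable_finsetSum _ fun a _ => (hτ' a).1.const_mul _
    · rw [integral_finsetSum _ fun a _ => (hτ' a).1.const_mul _]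
      refine Finset.sum_eq_zero fun a _ => ?_
      rw [integral_const_mul, (hτ' a).2, mul_zero]

end Wodzicki

end

theorem mainTheorem2 {n : ℕ} {U : Set (Wodzicki.Base n)} (hU : IsOpen U)
    {χ : Wodzicki.Cot n → ℂ} (hχ : Wodzicki.IsCutoff U χ)
    (β : Wodzicki.Form n) (hβ : β ∈ Wodzicki.classicalForms U χ)
    (hsupp : Wodzicki.CompactlySupported U β) :
    Wodzicki.extD β ∈ Wodzicki.classicalForms U χ ∧
      Wodzicki.CompactlySupported U (Wodzicki.extD β) ∧
      Wodzicki.ResIntegrable U χ (Wodzicki.extD β) ∧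
      Wodzicki.res U χ (Wodzicki.extD β) = 0 := by
  obtain ⟨τ, hτ, hint, hzero⟩ :=
    Wodzicki.exists_isComponent_coeff_extD hU hχ hβ hsupp _ Finset.univ Finset.univ rfl
  have heq := hτ.eqOn_component hU hχ
  refine ⟨Wodzicki.extD_mem_classicalForms hU hχ hβ, hsupp.extD hU, ?_, ?_⟩
  · refine hint.congr ?_
    -- The chosen component agrees with `τ` only over `U`, which suffices almost everywhere.
    have hae : ∀ᵐ q ∂((volume : Measure (Wodzicki.Base n)).restrict U).prod
        (volume : Measure (Wodzicki.Base n)).toSphere, q.1 ∈ U :=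
      Measure.quasiMeasurePreserving_fst.ae (ae_restrict_mem hU.measurableSet)
    filter_upwards [hae] with q hq
    exact (heq ⟨hq, Wodzicki.sphere_ne_zero q.2⟩).symm
  · rw [integral_prod _ hint] at hzero
    rw [← hzero]
    refine setIntegral_congr_fun hU.measurableSet fun x hx => ?_
    exact integral_congr_ae (.of_forall fun θ => heq ⟨hx, Wodzicki.sphere_ne_zero θ⟩)
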